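/- There is a universal constant $C>0$ such that the following holds. Let $d_u\ge 0$, $T\ge L\ge 1$ be integers, $0<\delta\le\frac12$ and $K\ge 0$. Let $u(0),\dots,u(T-1)$ be independent random vectors in $\mathbb R^{d_u}$ that are zero-mean, have identity covariance, $\mathbb E[u(t)u(t)^\top]=I_{d_u}$, and are $K$-sub-gaussian, i.e. for every $t$ $$\sup_{v\in\mathbb R^{d_u},\,\|v\|=1}\ \inf\{s>0:\ \mathbb E[\exp(\langle u(t),v\rangle^2/s^2)-1]\le 1\}\ \le K .$$ Let $U\in\mathbb R^{T\times (L+1)d_u}$ be the block Toeplitz matrix with $T\times(L+1)$ blocks of size $1\times d_u$ whose $(i,j)$-th block ($0\le i<T$, $0\le j\le L$) is $u(i-j)^\top$ if $i\ge j$ and $0$ otherwise. Then, with probability at least $1-\delta$, $$\bigl\|U^\top U-T\,I_{(L+1)d_u}\bigr\|\ \le\ CK^2\Bigl(L d_u\log\tfrac{T}{\delta}+\sqrt{T L d_u\log\tfrac{T}{\delta}}\Bigr),$$ where $\|\cdot\|$ is the operator norm induced by the Euclidean norm. -/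

import Mathlib

open MeasureTheory ProbabilityTheory
open scoped ENNReal NNReal Matrix RealInnerProductSpace Matrix.Norms.L2Operator

/-- The block Toeplitz matrix `Toep_{a × b}(F)` of a sequence `F(0), …, F(a-1)` of `m × n`
matrices: it has `a × b` blocks, and its `(i, j)` block is `F(i - j)` if `i ≥ j`, and `0` otherwise.
A row index is a pair (block row, row inside the block), and similarly for columns. -/
def blockToeplitz {R m n : Type*} [Zero R] (a b : ℕ) (F : Fin a → Matrix m n R) :
    Matrix (Fin a × m) (Fin b × n) R :=
  Matrix.of fun p q =>
    if (q.1 : ℕ) ≤ (p.1 : ℕ) then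
      F ⟨(p.1 : ℕ) - (q.1 : ℕ), lt_of_le_of_lt (Nat.sub_le _ _) p.1.isLt⟩ p.2 q.2
    else 0

/-- A vector `x ∈ ℝᵈ` as the `1 × d` matrix `xᵀ`. -/
def rowMatrix {d : ℕ} (x : EuclideanSpace ℝ (Fin d)) : Matrix (Fin 1) (Fin d) ℝ :=
  Matrix.of fun _ j => x j

/-- The sub-gaussian norm `inf {s > 0 : E[exp((X/s)²) - 1] ≤ 1}` of a real random variable. The
expectation of the nonnegative integrand is taken in `[0, ∞]`, and the infimum of the empty set
is `∞`. -/
noncomputable def psi2Norm {Ω : Type*} [MeasurableSpace Ω] (μ : Measure Ω) (X : Ω → ℝ) : ℝ≥0∞ :=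
  sInf {r : ℝ≥0∞ | ∃ s : ℝ, 0 < s ∧ r = ENNReal.ofReal s ∧
    ∫⁻ ω, ENNReal.ofReal (Real.exp ((X ω / s) ^ 2) - 1) ∂μ ≤ 1}

/-- The sub-gaussian norm of a random vector: the supremum of the sub-gaussian norms of its
one-dimensional marginals `⟨X, v⟩` over unit vectors `v`. -/
noncomputable def psi2NormVec {Ω : Type*} [MeasurableSpace Ω] {d : ℕ} (μ : Measure Ω)
    (X : Ω → EuclideanSpace ℝ (Fin d)) : ℝ≥0∞ :=
  ⨆ v ∈ Metric.sphere (0 : EuclideanSpace ℝ (Fin d)) 1, psi2Norm μ (fun ω => ⟪X ω, v⟫)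

/-- `X` is sub-gaussian with constant `K`. -/
def IsSubGaussianVec {Ω : Type*} [MeasurableSpace Ω] {d : ℕ} (μ : Measure Ω)
    (X : Ω → EuclideanSpace ℝ (Fin d)) (K : ℝ≥0) : Prop :=
  psi2NormVec μ X ≤ (K : ℝ≥0∞)

/-- `X` has identity second-moment matrix: `E[X Xᵀ] = I`. -/
def IsIsotropic {Ω : Type*} [MeasurableSpace Ω] {d : ℕ} (μ : Measure Ω)
    (X : Ω → EuclideanSpace ℝ (Fin d)) : Prop :=
  ∀ i j : Fin d, ∫ ω, X ω i * X ω j ∂μ = (1 : Matrix (Fin d) (Fin d) ℝ) i j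

/-- The `T × (L+1)` block Toeplitz matrix `Toep_{T × (L+1)}((u(t)ᵀ)_{0 ≤ t < T})`. -/
def inputMatrix {d T : ℕ} (L : ℕ) (u : Fin T → EuclideanSpace ℝ (Fin d)) :
    Matrix (Fin T × Fin 1) (Fin (L + 1) × Fin d) ℝ :=
  blockToeplitz T (L + 1) fun t => rowMatrix (u t)

/-! A net in all `(L + 1) * d` dimensions would cost an extra factor of order `L`. The Toeplitz
structure avoids it. For a stacked vector `v`, the form of `Uᵀ U` is the squared norm of the first
`T` entries of the convolution of `u` with `v`. The full convolution has `T + L` entries, and its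
Gram matrix depends only on the difference of the block indices, so Fourier analysis reduces it to
`2 * L + 1` Hermitian symbols of size `d` (`sum_bandForm_fourier`,
`abs_convSq_sub_le_of_symbolForm`). A union bound over the frequencies and over a net in real
dimension `2 * d` then suffices (`measure_not_convSq_le`).

At a fixed frequency and direction the symbol is a sum of two band forms `∑_{|s-t| ≤ L} x_s x_t` in
independent centred sub-gaussian scalars. Such a form deviates from its mean by at most a multiple
of `κ (√(s L T) + L s)`, except with probability `2 exp (-s)` (`measure_abs_bandForm_sub_ge_le`).
The diagonal is a sum of independent sub-exponential variables. The off-diagonal part is the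
martingale `∑ x_t * pastSum_t`, whose quadratic variation is controlled by splitting time into
residue classes modulo `L`, where the past windows are disjoint (`lintegral_exp_sum_pastSum_sq_le`).

The `L` extra entries of the convolution involve only the last `L` inputs, so they are bounded by
the same estimate with `T` replaced by `L` (`convSq_le_truncConvSq_add`). The resulting additive `L`
is absorbed because isotropy forces `K ≥ 1`. The choice `s = 20 d log (T / δ)` pays for the union
bound. -/

/-! ### Scalar exponential inequalities and the Gaussian square. -/

theorem Real.exp_le_add_exp_sq (y : ℝ) : Real.exp y ≤ y + Real.exp (y ^ 2) := by
  have h2 := Real.add_one_le_exp (y ^ 2)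
  rcases le_or_gt |y| 1 with h | h
  · have := (abs_le.1 (Real.abs_exp_sub_one_sub_id_le h)).2
    linarith
  · rcases lt_abs.1 h with h | h
    · have : Real.exp y ≤ Real.exp (y ^ 2) := Real.exp_le_exp.2 (by nlinarith)
      linarith
    · have : Real.exp y ≤ 1 := Real.exp_le_one_iff.2 (by linarith)
      nlinarith

theorem Real.exp_le_one_add_add_sq_mul_exp_abs (y : ℝ) :
    Real.exp y ≤ 1 + y + y ^ 2 * Real.exp |y| := by
  have h := Complex.norm_exp_sub_sum_le_norm_mul_exp (y : ℂ) 2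
  simp only [Finset.sum_range_succ, Finset.range_zero, Finset.sum_empty, zero_add, pow_zero,
    Nat.factorial_zero, Nat.cast_one, div_one, pow_one, Nat.factorial_one, Complex.norm_real,
    Real.norm_eq_abs, sq_abs] at h
  have h' : ‖((Real.exp y - (1 + y) : ℝ) : ℂ)‖ ≤ y ^ 2 * Real.exp |y| := by
    push_cast
    exact h
  rw [Complex.norm_real, Real.norm_eq_abs] at h'
  linarith [(abs_le.1 h').2]

/-- The integral equals `(1 - 2a)^(-1/2)`, and `(1 + 4a)(1 - 2a) ≥ 1` for `0 ≤ a ≤ 1/4`. -/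
theorem lintegral_exp_sq_gaussianReal_le {a : ℝ} (ha : 0 ≤ a) (ha' : 4 * a ≤ 1) :
    ∫⁻ g, ENNReal.ofReal (Real.exp (a * g ^ 2)) ∂(gaussianReal 0 1)
      ≤ ENNReal.ofReal (Real.exp (2 * a)) := by
  have hb : 0 < 1 / 2 - a := by linarith
  rw [gaussianReal_of_var_ne_zero 0 one_ne_zero,
    lintegral_withDensity_eq_lintegral_mul _ (measurable_gaussianPDF 0 1) (by fun_prop)]
  have h1 : ∀ g : ℝ, (gaussianPDF 0 1 * fun g => ENNReal.ofReal (Real.exp (a * g ^ 2))) g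
      = ENNReal.ofReal ((√(2 * Real.pi))⁻¹ * Real.exp (-(1 / 2 - a) * g ^ 2)) := by
    intro g
    rw [Pi.mul_apply, gaussianPDF, ← ENNReal.ofReal_mul (gaussianPDFReal_nonneg _ _ _),
      gaussianPDFReal]
    congr 1
    simp only [NNReal.coe_one, mul_one, sub_zero]
    rw [mul_assoc, ← Real.exp_add]
    congr 2
    ring
  simp_rw [h1]
  rw [← ofReal_integral_eq_lintegral_ofReal ((integrable_exp_neg_mul_sq hb).const_mul _)
    (Filter.Eventually.of_forall fun g => by positivity), integral_const_mul, integral_gaussian]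
  apply ENNReal.ofReal_le_ofReal
  rw [← Real.sqrt_inv, ← Real.sqrt_mul (by positivity)]
  apply Real.sqrt_le_iff.2 ⟨by positivity, ?_⟩
  rw [← Real.exp_nat_mul]
  have h2 : (2 * Real.pi)⁻¹ * (Real.pi / (1 / 2 - a)) = 1 / (1 - 2 * a) := by
    have := Real.pi_pos.ne'
    have : 1 - 2 * a ≠ 0 := by linarith
    field_simp
  rw [h2, div_le_iff₀ (by linarith)]
  have h3 := Real.add_one_le_exp (4 * a)
  have h4 : ((2 : ℕ) : ℝ) * (2 * a) = 4 * a := by push_cast; ring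
  rw [h4]
  nlinarith

/-! ### Exponential moments of a sub-gaussian variable and of its square. -/

section
variable {Ω : Type*} [MeasurableSpace Ω] {μ : Measure Ω} {X : Ω → ℝ}

theorem lintegral_exp_mul_le_of_hasSubgaussianMGF {c : ℝ≥0} (h : HasSubgaussianMGF X c μ) (t : ℝ) :
    ∫⁻ ω, ENNReal.ofReal (Real.exp (t * X ω)) ∂μ ≤ ENNReal.ofReal (Real.exp (c * t ^ 2 / 2)) := by
  rw [← ofReal_integral_eq_lintegral_ofReal (h.integrable_exp_mul t)
    (Filter.Eventually.of_forall fun _ => (Real.exp_pos _).le)]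
  exact ENNReal.ofReal_le_ofReal (h.mgf_le t)

/-- The square of a sub-gaussian variable is sub-exponential; the proof randomizes with an
auxiliary Gaussian variable. -/
theorem lintegral_exp_mul_sq_le_of_hasSubgaussianMGF [SFinite μ] {c : ℝ≥0} (hX : Measurable X)
    (h : HasSubgaussianMGF X c μ) {l : ℝ} (hl : 0 ≤ l) (hlc : 4 * (l * c) ≤ 1) :
    ∫⁻ ω, ENNReal.ofReal (Real.exp (l * X ω ^ 2)) ∂μ ≤ ENNReal.ofReal (Real.exp (2 * (l * c))) := by
  have key : ∀ y : ℝ, ENNReal.ofReal (Real.exp (l * y ^ 2))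
      = ∫⁻ g, ENNReal.ofReal (Real.exp (√(2 * l) * g * y)) ∂(gaussianReal 0 1) := by
    intro y
    have h1 := congrFun (mgf_id_gaussianReal (μ := 0) (v := 1)) (√(2 * l) * y)
    simp only [mgf, id, zero_mul, NNReal.coe_one, one_mul, zero_add] at h1
    rw [mul_pow, Real.sq_sqrt (by positivity)] at h1
    have h2 : Real.exp (l * y ^ 2)
        = ∫ g, Real.exp (√(2 * l) * y * g) ∂(gaussianReal 0 1) := by
      rw [h1]; congr 1; ring
    rw [h2, ofReal_integral_eq_lintegral_ofReal (integrable_exp_mul_gaussianReal _)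
      (Filter.Eventually.of_forall fun _ => (Real.exp_pos _).le)]
    congr 1; ext g; congr 2; ring
  simp_rw [key]
  rw [lintegral_lintegral_swap (by fun_prop)]
  refine le_trans (lintegral_mono fun g => lintegral_exp_mul_le_of_hasSubgaussianMGF h _) ?_
  refine le_trans (le_of_eq ?_) (lintegral_exp_sq_gaussianReal_le (by positivity) hlc)
  congr 1; ext g; congr 2
  rw [mul_pow, Real.sq_sqrt (by positivity)]
  ring

/-- `X` is centred and `E[exp(X²/κ)] ≤ 2`. -/
structure CentredSqExp (X : Ω → ℝ) (κ : ℝ) (μ : Measure Ω) : Prop where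
  measurable : Measurable X
  mean : ∫ ω, X ω ∂μ = 0
  integrable_exp : Integrable (fun ω => Real.exp (X ω ^ 2 / κ)) μ
  integral_exp_le : ∫ ω, Real.exp (X ω ^ 2 / κ) ∂μ ≤ 2

namespace CentredSqExp
variable {κ : ℝ}

theorem integrable_sq (h : CentredSqExp X κ μ) (hκ : 0 < κ) : Integrable (fun ω => X ω ^ 2) μ := by
  have := h.measurable
  refine (h.integrable_exp.const_mul κ).mono' (by fun_prop) (Filter.Eventually.of_forall fun ω => ?_)
  rw [Real.norm_of_nonneg (by positivity)]
  have := Real.add_one_le_exp (X ω ^ 2 / κ)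
  rw [← div_le_iff₀' hκ]
  linarith

variable [IsProbabilityMeasure μ]

theorem integral_sq_le (h : CentredSqExp X κ μ) (hκ : 0 < κ) : ∫ ω, X ω ^ 2 ∂μ ≤ κ := by
  have h1 : ∫ ω, (X ω ^ 2 / κ + 1) ∂μ ≤ ∫ ω, Real.exp (X ω ^ 2 / κ) ∂μ :=
    integral_mono (((h.integrable_sq hκ).div_const κ).add (integrable_const 1)) h.integrable_exp
      fun ω => Real.add_one_le_exp _
  rw [integral_add ((h.integrable_sq hκ).div_const κ) (integrable_const 1), integral_div] at h1
  simp only [integral_const, probReal_univ, one_smul] at h1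
  have h2 : (∫ ω, X ω ^ 2 ∂μ) / κ ≤ 1 := by linarith [h.integral_exp_le]
  rwa [div_le_one hκ] at h2

theorem integrable (h : CentredSqExp X κ μ) (hκ : 0 < κ) : Integrable X μ := by
  refine ((h.integrable_sq hκ).add (integrable_const 1)).mono' h.measurable.aestronglyMeasurable
    (Filter.Eventually.of_forall fun ω => ?_)
  simp only [Pi.add_apply, Real.norm_eq_abs]
  rw [abs_le]
  constructor <;> nlinarith [sq_nonneg (X ω - 1), sq_nonneg (X ω + 1), sq_nonneg (X ω)]

/-- By convexity `exp (a y) ≤ a exp y + (1 - a)`, so the mean is at most `1 + a ≤ exp a`. This gives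
a bound tending to `1` with `a`. -/
theorem integral_exp_mul_le (h : CentredSqExp X κ μ) {a : ℝ} (ha0 : 0 ≤ a) (ha : a ≤ 1) :
    Integrable (fun ω => Real.exp (a * (X ω ^ 2 / κ))) μ ∧
      ∫ ω, Real.exp (a * (X ω ^ 2 / κ)) ∂μ ≤ Real.exp a := by
  have hm := h.measurable
  have hpt : ∀ ω, Real.exp (a * (X ω ^ 2 / κ)) ≤ a * Real.exp (X ω ^ 2 / κ) + (1 - a) := fun ω => by
    have := convexOn_exp.2 (Set.mem_univ (X ω ^ 2 / κ)) (Set.mem_univ 0) ha0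
      (show 0 ≤ 1 - a by linarith) (by ring)
    simpa using this
  have hint : Integrable (fun ω => a * Real.exp (X ω ^ 2 / κ) + (1 - a)) μ :=
    (h.integrable_exp.const_mul a).add (integrable_const _)
  have hI : Integrable (fun ω => Real.exp (a * (X ω ^ 2 / κ))) μ :=
    hint.mono' (by fun_prop) (Filter.Eventually.of_forall fun ω => by
      rw [Real.norm_of_nonneg (Real.exp_pos _).le]; exact hpt ω)
  refine ⟨hI, (integral_mono hI hint hpt).trans ?_⟩
  rw [integral_add (h.integrable_exp.const_mul a) (integrable_const _), integral_const_mul]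
  simp only [integral_const, probReal_univ, one_smul]
  nlinarith [h.integral_exp_le, Real.add_one_le_exp a]

/-- For small `t`, `exp y ≤ y + exp (y²)` removes the linear term by centring. For large `t`,
Young's inequality `t X ≤ κ t² / 2 + X² / (2κ)` is enough, since the leftover `exp (1/2)` is at most
`exp (κ t² / 2)`. -/
theorem exp_mul_le (h : CentredSqExp X κ μ) (hκ : 0 < κ) (t : ℝ) :
    Integrable (fun ω => Real.exp (t * X ω)) μ ∧
      ∫ ω, Real.exp (t * X ω) ∂μ ≤ Real.exp (κ * t ^ 2) := by
  have hm := h.measurable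
  rcases le_or_gt (κ * t ^ 2) 1 with hle | hgt
  · obtain ⟨hI, hb⟩ := h.integral_exp_mul_le (a := κ * t ^ 2) (by positivity) hle
    have hpt : ∀ ω, Real.exp (t * X ω) ≤ t * X ω + Real.exp (κ * t ^ 2 * (X ω ^ 2 / κ)) := fun ω => by
      refine (Real.exp_le_add_exp_sq _).trans (le_of_eq ?_)
      congr 2; field_simp
    have hint := ((h.integrable hκ).const_mul t).add hI
    have hJ : Integrable (fun ω => Real.exp (t * X ω)) μ :=
      hint.mono' (by fun_prop) (Filter.Eventually.of_forall fun ω => by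
        rw [Real.norm_of_nonneg (Real.exp_pos _).le]; exact hpt ω)
    refine ⟨hJ, (integral_mono hJ hint hpt).trans ?_⟩
    simp only [Pi.add_apply]
    rw [integral_add ((h.integrable hκ).const_mul t) hI, integral_const_mul, h.mean]
    linarith
  · obtain ⟨hI, hb⟩ := h.integral_exp_mul_le (a := 1 / 2) (by norm_num) (by norm_num)
    have hpt : ∀ ω, Real.exp (t * X ω)
        ≤ Real.exp (κ * t ^ 2 / 2) * Real.exp (1 / 2 * (X ω ^ 2 / κ)) := fun ω => by
      rw [← Real.exp_add, Real.exp_le_exp]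
      have : 0 ≤ (κ * t - X ω) ^ 2 / (2 * κ) := by positivity
      have h2 : (κ * t - X ω) ^ 2 / (2 * κ) = κ * t ^ 2 / 2 + 1 / 2 * (X ω ^ 2 / κ) - t * X ω := by
        field_simp; ring
      linarith
    have hint := hI.const_mul (Real.exp (κ * t ^ 2 / 2))
    have hJ : Integrable (fun ω => Real.exp (t * X ω)) μ :=
      hint.mono' (by fun_prop) (Filter.Eventually.of_forall fun ω => by
        rw [Real.norm_of_nonneg (Real.exp_pos _).le]; exact hpt ω)
    refine ⟨hJ, (integral_mono hJ hint hpt).trans ?_⟩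
    rw [integral_const_mul]
    calc _ ≤ Real.exp (κ * t ^ 2 / 2) * Real.exp (1 / 2) := by gcongr
      _ ≤ _ := by rw [← Real.exp_add, Real.exp_le_exp]; linarith

theorem hasSubgaussianMGF (h : CentredSqExp X κ μ) (hκ : 0 < κ) :
    HasSubgaussianMGF X (2 * κ).toNNReal μ where
  integrable_exp_mul t := (h.exp_mul_le hκ t).1
  mgf_le t := by
    refine ((h.exp_mul_le hκ t).2).trans (le_of_eq ?_)
    rw [Real.coe_toNNReal _ (by positivity)]
    congr 1; ring

/-- In the second-order Taylor bound the linear term has mean zero. In the remainder, `w²` and the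
exponential are each traded for `exp (w / 4)`; together they cost at most `exp (X² / κ)` up to a
constant. -/
theorem lintegral_exp_sq_sub_le (h : CentredSqExp X κ μ) (hκ : 0 < κ) {t : ℝ}
    (ht : |t| * κ ≤ 1 / 4) :
    ∫⁻ ω, ENNReal.ofReal (Real.exp (t * (X ω ^ 2 - ∫ ω', X ω' ^ 2 ∂μ))) ∂μ
      ≤ ENNReal.ofReal (Real.exp (128 * (κ * t) ^ 2)) := by
  have hm := h.measurable
  have hs := h.integrable_sq hκ
  set m := ∫ ω', X ω' ^ 2 ∂μ with hmdef
  have hm0 : 0 ≤ m := integral_nonneg fun ω => sq_nonneg _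
  have hmκ : m ≤ κ := h.integral_sq_le hκ
  have hpt : ∀ ω, Real.exp (t * (X ω ^ 2 - m))
      ≤ 1 + t * (X ω ^ 2 - m) + 64 * (κ * t) ^ 2 * Real.exp (X ω ^ 2 / κ) := by
    intro ω
    refine (Real.exp_le_one_add_add_sq_mul_exp_abs _).trans (add_le_add le_rfl ?_)
    set z := X ω ^ 2 - m
    set w := |z| / κ with hw
    have hzw : |z| = κ * w := by rw [hw]; field_simp
    have hw0 : 0 ≤ w := by positivity
    have hw1 : w ≤ X ω ^ 2 / κ + 1 := by
      rw [hw, div_le_iff₀ hκ]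
      have : (X ω ^ 2 / κ + 1) * κ = X ω ^ 2 + κ := by field_simp
      rw [this, abs_le]
      constructor <;> nlinarith [sq_nonneg (X ω)]
    have e1 : (t * z) ^ 2 = (κ * t) ^ 2 * w ^ 2 := by
      rw [mul_pow, ← sq_abs z, hzw]; ring
    have e2 : Real.exp |t * z| ≤ Real.exp (w / 4) := by
      rw [Real.exp_le_exp, abs_mul, hzw]
      nlinarith
    have e3 : w ^ 2 ≤ 32 * Real.exp (w / 4) := by
      have := Real.quadratic_le_exp_of_nonneg (x := w / 4) (by positivity)
      nlinarith
    have e4 : Real.exp (w / 4) * Real.exp (w / 4) ≤ 2 * Real.exp (X ω ^ 2 / κ) := by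
      rw [← Real.exp_add]
      have h1 : Real.exp (w / 4 + w / 4) ≤ Real.exp (X ω ^ 2 / κ + 1 / 2) := by
        rw [Real.exp_le_exp]
        have : 0 ≤ X ω ^ 2 / κ := by positivity
        linarith
      refine h1.trans ?_
      rw [Real.exp_add, mul_comm]
      have h2 : Real.exp (1 / 2) ≤ 2 := by
        have h3 : Real.exp (1 / 2) ^ 2 ≤ 2 ^ 2 := by
          rw [← Real.exp_nat_mul]
          have := Real.exp_one_lt_d9
          norm_num
          linarith
        nlinarith [Real.exp_pos (1 / 2)]
      gcongr
    rw [e1]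
    calc (κ * t) ^ 2 * w ^ 2 * Real.exp |t * z|
        ≤ (κ * t) ^ 2 * (32 * Real.exp (w / 4)) * Real.exp (w / 4) := by gcongr
      _ = 32 * (κ * t) ^ 2 * (Real.exp (w / 4) * Real.exp (w / 4)) := by ring
      _ ≤ 32 * (κ * t) ^ 2 * (2 * Real.exp (X ω ^ 2 / κ)) := by gcongr
      _ = _ := by ring
  have hi0 : Integrable (fun ω => t * (X ω ^ 2 - m)) μ :=
    (hs.sub (integrable_const m)).const_mul t
  have hi1 : Integrable (fun ω => 1 + t * (X ω ^ 2 - m)) μ := (integrable_const 1).add hi0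
  have hi2 := h.integrable_exp.const_mul (64 * (κ * t) ^ 2)
  have hint := hi1.add hi2
  have hJ : Integrable (fun ω => Real.exp (t * (X ω ^ 2 - m))) μ :=
    hint.mono' (by fun_prop) (Filter.Eventually.of_forall fun ω => by
      rw [Real.norm_of_nonneg (Real.exp_pos _).le]; exact hpt ω)
  rw [← ofReal_integral_eq_lintegral_ofReal hJ
    (Filter.Eventually.of_forall fun _ => (Real.exp_pos _).le)]
  apply ENNReal.ofReal_le_ofReal
  refine (integral_mono hJ hint hpt).trans ?_
  simp only [Pi.add_apply]
  rw [integral_add hi1 hi2, integral_const_mul, integral_add (integrable_const 1) hi0,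
    integral_const_mul, integral_sub hs (integrable_const m)]
  simp only [integral_const, probReal_univ, one_smul, ← hmdef, sub_self, mul_zero, add_zero]
  have := Real.add_one_le_exp (128 * (κ * t) ^ 2)
  nlinarith [h.integral_exp_le, sq_nonneg (κ * t)]

end CentredSqExp
end

/-! ### Independence of disjoint blocks of coordinates. -/

section
variable {Ω : Type*} [MeasurableSpace Ω] {μ : Measure Ω}

/-- Zeroing the other coordinates, rather than restricting to a subtype, lets functions of the whole
family such as `pastSum` be applied to each block. -/
theorem ProbabilityTheory.iIndepFun.indepFun_restrict {ι : Type*} [DecidableEq ι]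
    {x : ι → Ω → ℝ} (h : iIndepFun x μ) (hx : ∀ i, Measurable (x i)) {S R : Finset ι}
    (hSR : Disjoint S R) :
    IndepFun (fun ω i => if i ∈ S then x i ω else 0) (fun ω i => if i ∈ R then x i ω else 0) μ := by
  have key : ∀ Q : Finset ι, Measurable
      (fun (z : Q → ℝ) (i : ι) => if hi : i ∈ Q then z ⟨i, hi⟩ else 0) := fun Q => by
    refine measurable_pi_lambda _ fun i => ?_
    by_cases hi : i ∈ Q
    · simpa [hi] using measurable_pi_apply _
    · simp [hi]
  have := (h.indepFun_finset S R hSR hx).comp (key S) (key R)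
  simpa [Function.comp_def] using this

theorem measurable_ite_family {ι : Type*} [DecidableEq ι] {x : ι → Ω → ℝ}
    (hx : ∀ i, Measurable (x i)) (S : Finset ι) :
    Measurable (fun ω i => if i ∈ S then x i ω else 0) := by
  refine measurable_pi_lambda _ fun i => ?_
  by_cases hi : i ∈ S <;> simp [hi, hx i]

variable [IsProbabilityMeasure μ]

/-- A substitute for conditioning on `Y`: by independence and Tonelli, `Y` may be frozen while `Z`
is integrated out. -/
theorem lintegral_le_lintegral_of_indepFun {α β : Type*} [MeasurableSpace α] [MeasurableSpace β]
    {Y : Ω → α} {Z : Ω → β} (hY : Measurable Y) (hZ : Measurable Z) (h : IndepFun Y Z μ)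
    {F : α → β → ℝ≥0∞} (hF : Measurable (Function.uncurry F)) {G : α → ℝ≥0∞}
    (hFG : ∀ y, ∫⁻ ω, F y (Z ω) ∂μ ≤ G y) :
    ∫⁻ ω, F (Y ω) (Z ω) ∂μ ≤ ∫⁻ ω, G (Y ω) ∂μ := by
  have h1 : ∫⁻ ω, F (Y ω) (Z ω) ∂μ
      = ∫⁻ p, Function.uncurry F p ∂(μ.map fun ω => (Y ω, Z ω)) := by
    rw [lintegral_map hF (hY.prodMk hZ)]; rfl
  rw [h1, (indepFun_iff_map_prod_eq_prod_map_map hY.aemeasurable hZ.aemeasurable).1 h]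
  have := Measure.isProbabilityMeasure_map (μ := μ) hZ.aemeasurable
  have := Measure.isProbabilityMeasure_map (μ := μ) hY.aemeasurable
  rw [lintegral_prod _ hF.aemeasurable, lintegral_map hF.lintegral_prod_right' hY]
  refine lintegral_mono fun ω => ?_
  rw [lintegral_map (by fun_prop) hZ]
  exact hFG _

theorem lintegral_prod_comp_sum_of_disjoint {ι α : Type*} [Fintype ι] [DecidableEq ι]
    {x : ι → Ω → ℝ} (h : iIndepFun x μ) (hx : ∀ i, Measurable (x i)) (W : α → Finset ι)
    (A : Finset α) (hW : (A : Set α).PairwiseDisjoint W) {g : ℝ → ℝ≥0∞} (hg : Measurable g) :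
    ∫⁻ ω, ∏ a ∈ A, g (∑ i ∈ W a, x i ω) ∂μ = ∏ a ∈ A, ∫⁻ ω, g (∑ i ∈ W a, x i ω) ∂μ := by
  classical
  induction A using Finset.induction_on with
  | empty => simp
  | insert a A ha ih =>
    have hd : Disjoint (W a) (A.biUnion W) := by
      rw [Finset.disjoint_biUnion_right]
      intro b hb
      exact hW (by simp) (by simp [hb]) (by rintro rfl; exact ha hb)
    have hi := (h.indepFun_restrict hx hd).comp
      (φ := fun z => g (∑ i ∈ W a, z i)) (ψ := fun z => ∏ b ∈ A, g (∑ i ∈ W b, z i))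
      (by fun_prop) (by fun_prop)
    have e1 : ((fun z : ι → ℝ => g (∑ i ∈ W a, z i)) ∘ fun ω i => if i ∈ W a then x i ω else 0)
        = fun ω => g (∑ i ∈ W a, x i ω) := by
      ext ω
      simp only [Function.comp]
      congr 1
      exact Finset.sum_congr rfl fun i hi => by simp [hi]
    have e2 : ((fun z : ι → ℝ => ∏ b ∈ A, g (∑ i ∈ W b, z i)) ∘
        fun ω i => if i ∈ A.biUnion W then x i ω else 0)
        = fun ω => ∏ b ∈ A, g (∑ i ∈ W b, x i ω) := by
      ext ω
      simp only [Function.comp]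
      refine Finset.prod_congr rfl fun b hb => ?_
      congr 1
      refine Finset.sum_congr rfl fun i hi => ?_
      rw [if_pos (Finset.mem_biUnion.2 ⟨b, hb, hi⟩)]
    rw [e1, e2] at hi
    simp_rw [Finset.prod_insert ha]
    rw [← ih (hW.subset (by simp))]
    exact lintegral_mul_eq_lintegral_mul_lintegral_of_indepFun (by fun_prop) (by fun_prop) hi

/-! ### The off-diagonal martingale and its quadratic variation. -/

/-- The indices in the window of length `L` that precedes `t`. -/
def pastWindow {T : ℕ} (L : ℕ) (t : Fin T) : Finset (Fin T) :=
  {s | s < t ∧ (t : ℕ) ≤ s + L}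

theorem card_pastWindow_le {T : ℕ} (L : ℕ) (t : Fin T) : (pastWindow L t).card ≤ L := by
  have : ((pastWindow L t).map Fin.valEmbedding) ⊆ Finset.Ico (t - L : ℕ) t := by
    intro s hs
    simp only [pastWindow, Finset.mem_map, Finset.mem_filter, Finset.mem_univ, true_and,
      Fin.valEmbedding_apply, Finset.mem_Ico] at hs ⊢
    obtain ⟨a, ⟨h1, h2⟩, rfl⟩ := hs
    have := Fin.lt_def.1 h1
    omega
  have := Finset.card_le_card this
  rw [Finset.card_map, Nat.card_Ico] at this
  omega

/-- The sum of the `L` entries of `x` that precede `x t`. -/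
def pastSum {T : ℕ} (L : ℕ) (x : Fin T → ℝ) (t : Fin T) : ℝ := ∑ s ∈ pastWindow L t, x s

theorem measurable_pastSum {T : ℕ} (L : ℕ) (t : Fin T) :
    Measurable fun x : Fin T → ℝ => pastSum L x t := by
  unfold pastSum; fun_prop

variable {T : ℕ} {x : Fin T → Ω → ℝ}

/-- The exponential supermartingale: `pastSum` at time `t` depends only on earlier entries, so
integrating out the newest entry gives exactly the factor that the compensator cancels. -/
theorem lintegral_exp_martingale_le (h : iIndepFun x μ) (hx : ∀ t, Measurable (x t)) {c : ℝ≥0}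
    (hc : ∀ t, HasSubgaussianMGF (x t) c μ) (L : ℕ) (θ : ℝ) (n : ℕ) (hn : n ≤ T) :
    ∫⁻ ω, ENNReal.ofReal (Real.exp (∑ t : Fin T with t.val < n,
      (θ * x t ω * pastSum L (x · ω) t - c * (θ * pastSum L (x · ω) t) ^ 2 / 2))) ∂μ ≤ 1 := by
  induction n with
  | zero => simp
  | succ n ih =>
    refine le_trans ?_ (ih (by omega))
    have hmeas := measurable_pastSum (T := T) L
    set N : Fin T := ⟨n, hn⟩
    set S : Finset (Fin T) := {t | t.val < n} with hS
    have hins : ({t | t.val < n + 1} : Finset (Fin T)) = insert N S := by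
      ext t
      simp only [hS, Finset.mem_filter, Finset.mem_univ, true_and, Finset.mem_insert, N, Fin.ext_iff]
      omega
    have hNS : N ∉ S := by simp [hS, N]
    have hd : Disjoint S {N} := by simpa using hNS
    let M : (Fin T → ℝ) → ℝ := fun y =>
      ∑ t ∈ S, (θ * y t * pastSum L y t - c * (θ * pastSum L y t) ^ 2 / 2)
    have hM : Measurable M := by fun_prop
    -- Windows up to time `n` lie strictly before `n`, so zeroing the entries outside `S` leaves
    -- these past sums unchanged.
    have hpast : ∀ t : Fin T, t.val ≤ n → ∀ ω,
        pastSum L (fun i => if i ∈ S then x i ω else 0) t = pastSum L (x · ω) t := by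
      intro t ht ω
      refine Finset.sum_congr rfl fun s hs => ?_
      have : s < t := by
        simp only [pastWindow, Finset.mem_filter] at hs
        exact hs.2.1
      refine if_pos ?_
      simp only [hS, Finset.mem_filter, Finset.mem_univ, true_and]
      have := Fin.lt_def.1 this
      omega
    have hMx : ∀ ω, M (fun i => if i ∈ S then x i ω else 0) = M (x · ω) := by
      intro ω
      refine Finset.sum_congr rfl fun t ht => ?_
      have ht' : t.val < n := by simpa [hS] using ht
      simp only [hpast t ht'.le, if_pos ht]
    have key := lintegral_le_lintegral_of_indepFun (measurable_ite_family hx S)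
      (measurable_ite_family hx {N}) (h.indepFun_restrict hx hd)
      (F := fun y z => ENNReal.ofReal (Real.exp (M y +
        (θ * z N * pastSum L y N - c * (θ * pastSum L y N) ^ 2 / 2))))
      (G := fun y => ENNReal.ofReal (Real.exp (M y))) (by unfold Function.uncurry; fun_prop)
      (fun y => by
        have e : ∀ ω, ENNReal.ofReal (Real.exp (M y + (θ * (if N ∈ ({N} : Finset (Fin T)) then
            x N ω else 0) * pastSum L y N - c * (θ * pastSum L y N) ^ 2 / 2)))
            = ENNReal.ofReal (Real.exp (M y - c * (θ * pastSum L y N) ^ 2 / 2)) *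
              ENNReal.ofReal (Real.exp ((θ * pastSum L y N) * x N ω)) := by
          intro ω
          rw [← ENNReal.ofReal_mul (Real.exp_pos _).le, ← Real.exp_add]
          simp only [Finset.mem_singleton, if_true]
          congr 2; ring
        simp_rw [e]
        have hxN := hx N
        rw [lintegral_const_mul _ (by fun_prop)]
        refine (mul_le_mul_right (lintegral_exp_mul_le_of_hasSubgaussianMGF (hc N) _) _).trans ?_
        rw [← ENNReal.ofReal_mul (Real.exp_pos _).le, ← Real.exp_add]
        apply le_of_eq
        congr 2; ring)
    simp_rw [hMx] at key
    refine le_trans (le_of_eq ?_) key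
    congr 1; ext ω
    rw [hins, Finset.sum_insert hNS, hpast N le_rfl]
    simp only [Finset.mem_singleton, if_true]
    congr 2
    rw [add_comm]

theorem card_residue_class_mul_le (L : ℕ) (r : ℕ) :
    ({t : Fin T | t.val % L = r} : Finset (Fin T)).card * L ≤ T + L := by
  rcases Nat.eq_zero_or_pos L with rfl | hL
  · simp
  have : ({t : Fin T | t.val % L = r} : Finset (Fin T)).card ≤ (Finset.range (T / L + 1)).card := by
    refine Finset.card_le_card_of_injOn (fun t => t.val / L) ?_ ?_
    · intro t _
      simp only [Finset.coe_range, Set.mem_Iio]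
      exact Nat.lt_succ_of_le (Nat.div_le_div_right t.isLt.le)
    · intro t ht s hs hts
      simp only [Finset.coe_filter, Finset.mem_univ, true_and, Set.mem_ofPred_eq] at ht hs hts
      ext
      rw [← Nat.div_add_mod t.val L, ← Nat.div_add_mod s.val L, hts, ht, hs]
  rw [Finset.card_range] at this
  calc _ ≤ (T / L + 1) * L := Nat.mul_le_mul_right L this
    _ = T / L * L + L := by ring
    _ ≤ _ := Nat.add_le_add_right (Nat.div_mul_le_self T L) L

/-- Distinct indices in one class differ by at least `L`, the length of a window. -/
theorem pairwiseDisjoint_pastWindow (L : ℕ) (r : ℕ) :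
    (({t : Fin T | t.val % L = r} : Finset (Fin T)) : Set (Fin T)).PairwiseDisjoint
      (pastWindow L) := by
  have key : ∀ t s : Fin T, t.val % L = r → s.val % L = r → t < s →
      Disjoint (pastWindow L t) (pastWindow L s) := by
    intro t s ht hs hts
    rw [Finset.disjoint_left]
    intro a hat has
    simp only [pastWindow, Finset.mem_filter, Finset.mem_univ, true_and, Fin.lt_def] at hat has hts
    have h1 : t.val ≡ s.val [MOD L] := by rw [Nat.ModEq, ht, hs]
    have h2 := Nat.le_of_dvd (by omega) ((Nat.modEq_iff_dvd' hts.le).1 h1)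
    omega
  intro t ht s hs hts
  simp only [Finset.coe_filter, Finset.mem_univ, true_and, Set.mem_ofPred_eq] at ht hs
  rcases lt_or_gt_of_ne hts with h | h
  · exact key t s ht hs h
  · exact (key s t hs ht h).symm

/-- Neighbouring past sums are dependent, but within a residue class modulo `L` they are
independent. Each has variance proxy at most `c L`, and a class has at most `2T / L` members.
Jensen's inequality over the `L` classes multiplies the parameter by `L`. -/
theorem lintegral_exp_sum_pastSum_sq_le (h : iIndepFun x μ) (hx : ∀ t, Measurable (x t)) {c : ℝ≥0}
    (hc : ∀ t, HasSubgaussianMGF (x t) c μ) {L : ℕ} (hL : 1 ≤ L) (hLT : L ≤ T) {l : ℝ}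
    (hl : 0 ≤ l) (hlc : 4 * (l * c * L ^ 2) ≤ 1) :
    ∫⁻ ω, ENNReal.ofReal (Real.exp (l * ∑ t, pastSum L (x · ω) t ^ 2)) ∂μ
      ≤ ENNReal.ofReal (Real.exp (4 * (l * c * (L * T)))) := by
  have hL0 : (0 : ℝ) < L := by exact_mod_cast hL
  let A : ℕ → Finset (Fin T) := fun r => {t | t.val % L = r}
  have hpt : ∀ y : Fin T → ℝ, Real.exp (l * ∑ t, y t ^ 2)
      ≤ ∑ r ∈ Finset.range L, (1 / L : ℝ) * ∏ t ∈ A r, Real.exp (l * L * y t ^ 2) := by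
    intro y
    have h1 : l * ∑ t, y t ^ 2
        = ∑ r ∈ Finset.range L, (1 / L : ℝ) • ∑ t ∈ A r, l * L * y t ^ 2 := by
      rw [← Finset.sum_fiberwise_of_maps_to (t := Finset.range L) (g := fun t : Fin T => t.val % L)
        (fun t _ => Finset.mem_range.2 (Nat.mod_lt _ hL)), Finset.mul_sum]
      refine Finset.sum_congr rfl fun r _ => ?_
      rw [smul_eq_mul, ← Finset.mul_sum]
      field_simp
      rfl
    rw [h1]
    refine (convexOn_exp.map_sum_le (fun _ _ => by positivity) ?_ (fun _ _ => Set.mem_univ _)).trans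
      (le_of_eq ?_)
    · simp [hL0.ne']
    · simp only [Real.exp_sum, smul_eq_mul]
  have hmeas := measurable_pastSum (T := T) L
  have hsub : ∀ t, ∫⁻ ω, ENNReal.ofReal (Real.exp (l * L * (∑ s ∈ pastWindow L t, x s ω) ^ 2)) ∂μ
      ≤ ENNReal.ofReal (Real.exp (2 * (l * c * L ^ 2))) := by
    intro t
    have h1 := HasSubgaussianMGF.sum_of_iIndepFun h (s := pastWindow L t) (c := fun _ => c)
      fun i _ => hc i
    have h2 : ((∑ _s ∈ pastWindow L t, c : ℝ≥0) : ℝ) ≤ L * c := by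
      rw [Finset.sum_const, nsmul_eq_mul]
      push_cast
      have : ((pastWindow L t).card : ℝ) ≤ L := by exact_mod_cast card_pastWindow_le L t
      gcongr
    have h3 : l * L * ((∑ _s ∈ pastWindow L t, c : ℝ≥0) : ℝ) ≤ l * c * L ^ 2 := by
      calc _ ≤ l * L * (L * c) := by gcongr
        _ = _ := by ring
    refine (lintegral_exp_mul_sq_le_of_hasSubgaussianMGF (by fun_prop) h1 (by positivity)
      (by linarith)).trans ?_
    apply ENNReal.ofReal_le_ofReal
    rw [Real.exp_le_exp]
    linarith
  have hclass : ∀ r, ∫⁻ ω, ∏ t ∈ A r,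
      ENNReal.ofReal (Real.exp (l * L * (∑ s ∈ pastWindow L t, x s ω) ^ 2)) ∂μ
      ≤ ENNReal.ofReal (Real.exp (4 * (l * c * (L * T)))) := by
    intro r
    rw [lintegral_prod_comp_sum_of_disjoint h hx (pastWindow L) (A r)
      (pairwiseDisjoint_pastWindow L r)
      (g := fun y => ENNReal.ofReal (Real.exp (l * L * y ^ 2))) (by fun_prop)]
    refine (Finset.prod_le_prod' fun t _ => hsub t).trans ?_
    rw [Finset.prod_const, ← ENNReal.ofReal_pow (Real.exp_pos _).le, ← Real.exp_nat_mul]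
    apply ENNReal.ofReal_le_ofReal
    rw [Real.exp_le_exp]
    have h1 : ((A r).card * L : ℝ) ≤ 2 * T := by
      have : ((A r).card * L : ℝ) ≤ T + L := by exact_mod_cast card_residue_class_mul_le L r
      have : (L : ℝ) ≤ T := by exact_mod_cast hLT
      linarith
    calc ((A r).card : ℝ) * (2 * (l * c * L ^ 2)) = 2 * (l * c * L) * ((A r).card * L) := by ring
      _ ≤ 2 * (l * c * L) * (2 * T) := by gcongr
      _ = _ := by ring
  calc ∫⁻ ω, ENNReal.ofReal (Real.exp (l * ∑ t, pastSum L (x · ω) t ^ 2)) ∂μ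
      ≤ ∫⁻ ω, ∑ r ∈ Finset.range L, ENNReal.ofReal (1 / L) * ∏ t ∈ A r,
          ENNReal.ofReal (Real.exp (l * L * (∑ s ∈ pastWindow L t, x s ω) ^ 2)) ∂μ := by
        refine lintegral_mono fun ω => ?_
        refine (ENNReal.ofReal_le_ofReal (hpt _)).trans (le_of_eq ?_)
        rw [ENNReal.ofReal_sum_of_nonneg (fun _ _ => by positivity)]
        refine Finset.sum_congr rfl fun r _ => ?_
        rw [ENNReal.ofReal_mul (by positivity),
          ENNReal.ofReal_prod_of_nonneg (fun _ _ => (Real.exp_pos _).le)]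
        rfl
    _ = ∑ r ∈ Finset.range L, ENNReal.ofReal (1 / L) * ∫⁻ ω, ∏ t ∈ A r,
          ENNReal.ofReal (Real.exp (l * L * (∑ s ∈ pastWindow L t, x s ω) ^ 2)) ∂μ := by
        rw [lintegral_finsetSum _ (fun r _ => by fun_prop)]
        refine Finset.sum_congr rfl fun r _ => ?_
        rw [lintegral_const_mul _ (by fun_prop)]
    _ ≤ ∑ r ∈ Finset.range L, ENNReal.ofReal (1 / L) *
          ENNReal.ofReal (Real.exp (4 * (l * c * (L * T)))) := by
        gcongr with r _
        exact hclass r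
    _ = _ := by
        rw [Finset.sum_const, Finset.card_range, nsmul_eq_mul, ← mul_assoc,
          ← ENNReal.ofReal_natCast, ← ENNReal.ofReal_mul hL0.le]
        simp [hL0.ne']
end

/-! ### Concentration of the band form. -/

/-- The quadratic form `∑ x_s x_t` over all pairs with `|s - t| ≤ L`. -/
def bandForm {T : ℕ} (L : ℕ) (x : Fin T → ℝ) : ℝ :=
  ∑ s : Fin T, ∑ t : Fin T, if s.val ≤ t + L ∧ t.val ≤ s + L then x s * x t else 0

theorem bandForm_eq {T : ℕ} (L : ℕ) (x : Fin T → ℝ) :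
    bandForm L x = ∑ t, x t ^ 2 + 2 * ∑ t, x t * pastSum L x t := by
  have h1 : ∑ t, x t * pastSum L x t
      = ∑ t : Fin T, ∑ s : Fin T, if s < t ∧ t.val ≤ s + L then x t * x s else 0 := by
    refine Finset.sum_congr rfl fun t _ => ?_
    rw [pastSum, pastWindow, Finset.mul_sum, Finset.sum_filter]
  have h2 : ∑ t, x t ^ 2 = ∑ s : Fin T, ∑ t : Fin T, if s = t then x s * x t else 0 := by
    simp [sq]
  have h3 : ∑ t, x t * pastSum L x t
      = ∑ s : Fin T, ∑ t : Fin T, if s < t ∧ t.val ≤ s + L then x s * x t else 0 := by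
    rw [h1, Finset.sum_comm]
    refine Finset.sum_congr rfl fun t _ => Finset.sum_congr rfl fun s _ => ?_
    rw [mul_comm]
  rw [two_mul]
  nth_rw 1 [h1]
  rw [h2, h3, bandForm, ← Finset.sum_add_distrib, ← Finset.sum_add_distrib]
  refine Finset.sum_congr rfl fun s _ => ?_
  rw [← Finset.sum_add_distrib, ← Finset.sum_add_distrib]
  refine Finset.sum_congr rfl fun t _ => ?_
  simp only [Fin.lt_def, Fin.ext_iff]
  rcases lt_trichotomy s.val t.val with h | h | h
  · have a1 : ¬ s.val = t.val := h.ne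
    have a2 : ¬ t.val < s.val := by omega
    have a3 : s.val ≤ t + L := by omega
    simp [h, a1, a2, a3]
  · simp [h]
  · have a1 : ¬ s.val = t.val := h.ne'
    have a2 : ¬ s.val < t.val := by omega
    have a3 : t.val ≤ s + L := by omega
    simp [h, a1, a2, a3]

theorem Real.exp_add_le_half (a b : ℝ) :
    Real.exp (a + b) ≤ (1 / 2) * Real.exp (2 * a) + (1 / 2) * Real.exp (2 * b) := by
  have h := sq_nonneg (Real.exp a - Real.exp b)
  have h1 : Real.exp (2 * a) = Real.exp a ^ 2 := by rw [← Real.exp_nat_mul]; norm_num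
  have h2 : Real.exp (2 * b) = Real.exp b ^ 2 := by rw [← Real.exp_nat_mul]; norm_num
  rw [Real.exp_add, h1, h2]
  nlinarith

section
variable {Ω : Type*} [MeasurableSpace Ω] {μ : Measure Ω}

theorem lintegral_exp_add_le_half {A B : Ω → ℝ} (hA : Measurable A) (hB : Measurable B) {r : ℝ}
    (h1 : ∫⁻ ω, ENNReal.ofReal (Real.exp (2 * A ω)) ∂μ ≤ ENNReal.ofReal (Real.exp r))
    (h2 : ∫⁻ ω, ENNReal.ofReal (Real.exp (2 * B ω)) ∂μ ≤ ENNReal.ofReal (Real.exp r)) :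
    ∫⁻ ω, ENNReal.ofReal (Real.exp (A ω + B ω)) ∂μ ≤ ENNReal.ofReal (Real.exp r) := by
  calc _ ≤ ∫⁻ ω, (ENNReal.ofReal (1 / 2) * ENNReal.ofReal (Real.exp (2 * A ω))
        + ENNReal.ofReal (1 / 2) * ENNReal.ofReal (Real.exp (2 * B ω))) ∂μ := by
        refine lintegral_mono fun ω => ?_
        rw [← ENNReal.ofReal_mul (by norm_num), ← ENNReal.ofReal_mul (by norm_num),
          ← ENNReal.ofReal_add (by positivity) (by positivity)]
        exact ENNReal.ofReal_le_ofReal (Real.exp_add_le_half _ _)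
    _ = ENNReal.ofReal (1 / 2) * ∫⁻ ω, ENNReal.ofReal (Real.exp (2 * A ω)) ∂μ
        + ENNReal.ofReal (1 / 2) * ∫⁻ ω, ENNReal.ofReal (Real.exp (2 * B ω)) ∂μ := by
        rw [lintegral_add_left (by fun_prop), lintegral_const_mul _ (by fun_prop),
          lintegral_const_mul _ (by fun_prop)]
    _ ≤ ENNReal.ofReal (1 / 2) * ENNReal.ofReal (Real.exp r)
        + ENNReal.ofReal (1 / 2) * ENNReal.ofReal (Real.exp r) := by gcongr
    _ = _ := by
        rw [← add_mul, ← ENNReal.ofReal_add (by norm_num) (by norm_num)]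
        norm_num

theorem measure_le_of_lintegral_exp_le {A : Ω → ℝ} (hA : Measurable A) {τ r s : ℝ}
    (h : ∫⁻ ω, ENNReal.ofReal (Real.exp (A ω)) ∂μ ≤ ENNReal.ofReal (Real.exp r))
    (hs : r - τ ≤ -s) : μ {ω | τ ≤ A ω} ≤ ENNReal.ofReal (Real.exp (-s)) := by
  have h1 : {ω | τ ≤ A ω} ⊆ {ω | ENNReal.ofReal (Real.exp τ) ≤ ENNReal.ofReal (Real.exp (A ω))} :=
    fun ω hω => ENNReal.ofReal_le_ofReal (Real.exp_le_exp.2 hω)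
  refine (measure_mono h1).trans ((meas_ge_le_lintegral_div (by fun_prop)
    (by simp [Real.exp_pos]) ENNReal.ofReal_ne_top).trans ?_)
  refine (ENNReal.div_le_div_right h _).trans ?_
  rw [← ENNReal.ofReal_div_of_pos (Real.exp_pos _), ← Real.exp_sub]
  exact ENNReal.ofReal_le_ofReal (Real.exp_le_exp.2 hs)

variable [IsProbabilityMeasure μ] {T : ℕ} {x : Fin T → Ω → ℝ}

/-- Adding and subtracting the compensator splits the exponent into a supermartingale part and a
multiple of the quadratic variation. Separating them doubles both exponents, hence the parameters `2
* θ` and `2 * c * θ ^ 2`. -/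
theorem lintegral_exp_sum_mul_pastSum_le (h : iIndepFun x μ) (hx : ∀ t, Measurable (x t)) {c : ℝ≥0}
    (hc : ∀ t, HasSubgaussianMGF (x t) c μ) {L : ℕ} (hL : 1 ≤ L) (hLT : L ≤ T) {θ : ℝ}
    (hθ : 8 * (c * θ * L) ^ 2 ≤ 1) :
    ∫⁻ ω, ENNReal.ofReal (Real.exp (θ * ∑ t, x t ω * pastSum L (x · ω) t)) ∂μ
      ≤ ENNReal.ofReal (Real.exp (8 * (c * θ) ^ 2 * (L * T))) := by
  have hmeas : ∀ t, Measurable fun ω => pastSum L (x · ω) t := fun t =>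
    (measurable_pastSum L t).comp (measurable_pi_lambda _ hx)
  have h1 := lintegral_exp_martingale_le h hx hc L (2 * θ) T le_rfl
  have h2 := lintegral_exp_sum_pastSum_sq_le h hx hc hL hLT (l := 2 * c * θ ^ 2) (by positivity)
    (by calc _ = 8 * (c * θ * L) ^ 2 := by ring
          _ ≤ 1 := hθ)
  have hd : ∀ ω, θ * ∑ t, x t ω * pastSum L (x · ω) t
      = (θ * ∑ t, x t ω * pastSum L (x · ω) t - c * θ ^ 2 * ∑ t, pastSum L (x · ω) t ^ 2)
        + c * θ ^ 2 * ∑ t, pastSum L (x · ω) t ^ 2 := fun ω => by ring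
  refine (lintegral_congr fun ω =>
    congrArg (fun z => ENNReal.ofReal (Real.exp z)) (hd ω)).trans_le ?_
  refine lintegral_exp_add_le_half (by fun_prop) (by fun_prop) ?_ ?_
  · refine le_trans (le_of_eq ?_) (h1.trans ?_)
    · congr 1; ext ω; congr 2
      rw [Finset.filter_true_of_mem (fun t _ => t.isLt), Finset.sum_sub_distrib, mul_sub,
        Finset.mul_sum, Finset.mul_sum, Finset.mul_sum, Finset.mul_sum]
      congr 1
      · exact Finset.sum_congr rfl fun t _ => by ring
      · exact Finset.sum_congr rfl fun t _ => by ring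
    · rw [← ENNReal.ofReal_one]
      apply ENNReal.ofReal_le_ofReal
      rw [Real.one_le_exp_iff]
      positivity
  · refine le_trans (le_of_eq ?_) (h2.trans (le_of_eq ?_))
    · congr 1; ext ω; congr 2; ring
    · congr 2; ring

theorem lintegral_exp_sum_sq_sub_le (h : iIndepFun x μ) {κ : ℝ} (hκ : 0 < κ)
    (hx : ∀ t, CentredSqExp (x t) κ μ) {θ : ℝ} (hθ : |θ| * κ ≤ 1 / 4) :
    ∫⁻ ω, ENNReal.ofReal (Real.exp (θ * ∑ t, (x t ω ^ 2 - ∫ ω', x t ω' ^ 2 ∂μ))) ∂μ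
      ≤ ENNReal.ofReal (Real.exp (128 * (κ * θ) ^ 2 * T)) := by
  have hi := h.comp (fun t y => ENNReal.ofReal (Real.exp (θ * (y ^ 2 - ∫ ω', x t ω' ^ 2 ∂μ))))
    (fun t => by fun_prop)
  have hm : ∀ t, Measurable (x t) := fun t => (hx t).measurable
  have := lintegral_prod_eq_prod_lintegral_of_indepFun Finset.univ _ hi (fun t => by
    simp only [Function.comp_def]; fun_prop)
  simp only [Function.comp] at this
  have e : ∀ ω, ENNReal.ofReal (Real.exp (θ * ∑ t, (x t ω ^ 2 - ∫ ω', x t ω' ^ 2 ∂μ)))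
      = ∏ t, ENNReal.ofReal (Real.exp (θ * (x t ω ^ 2 - ∫ ω', x t ω' ^ 2 ∂μ))) := by
    intro ω
    rw [Finset.mul_sum, Real.exp_sum, ENNReal.ofReal_prod_of_nonneg fun _ _ => (Real.exp_pos _).le]
  simp_rw [e]
  rw [this]
  refine (Finset.prod_le_prod' fun t _ => (hx t).lintegral_exp_sq_sub_le hκ hθ).trans ?_
  rw [Finset.prod_const, ← ENNReal.ofReal_pow (Real.exp_pos _).le, ← Real.exp_nat_mul]
  apply le_of_eq
  rw [Finset.card_univ, Fintype.card_fin]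
  congr 2; ring

/-- The diagonal enters at `2 * θ` and the martingale at `4 * θ` with proxy `2 * κ`; both give `512
= 128 * 2² = 8 * 8²`. The `24` in the hypothesis works because `24² = 576 ≥ 512`. -/
theorem lintegral_exp_bandForm_le (h : iIndepFun x μ) {κ : ℝ} (hκ : 0 < κ)
    (hx : ∀ t, CentredSqExp (x t) κ μ) {L : ℕ} (hL : 1 ≤ L) (hLT : L ≤ T) {θ : ℝ}
    (hθ : 24 * (|θ| * κ * L) ≤ 1) :
    ∫⁻ ω, ENNReal.ofReal (Real.exp (θ * (bandForm L (x · ω) - ∑ t, ∫ ω', x t ω' ^ 2 ∂μ))) ∂μ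
      ≤ ENNReal.ofReal (Real.exp (512 * (κ * θ) ^ 2 * (L * T))) := by
  have hm : ∀ t, Measurable (x t) := fun t => (hx t).measurable
  have hmeas : ∀ t, Measurable fun ω => pastSum L (x · ω) t := fun t =>
    (measurable_pastSum L t).comp (measurable_pi_lambda _ hm)
  have hL1 : (1 : ℝ) ≤ L := by exact_mod_cast hL
  have hd : ∀ ω, θ * (bandForm L (x · ω) - ∑ t, ∫ ω', x t ω' ^ 2 ∂μ)
      = θ * ∑ t, (x t ω ^ 2 - ∫ ω', x t ω' ^ 2 ∂μ)
        + 2 * θ * ∑ t, x t ω * pastSum L (x · ω) t := fun ω => by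
    rw [bandForm_eq, Finset.sum_sub_distrib]; ring
  refine (lintegral_congr fun ω =>
    congrArg (fun z => ENNReal.ofReal (Real.exp z)) (hd ω)).trans_le ?_
  have ht0 : 0 ≤ |θ| * κ := by positivity
  have ht1 : |θ| * κ ≤ |θ| * κ * L := le_mul_of_one_le_right ht0 hL1
  refine lintegral_exp_add_le_half (by fun_prop) (by fun_prop) ?_ ?_
  · have := lintegral_exp_sum_sq_sub_le h hκ hx (θ := 2 * θ) (by
      rw [abs_mul, abs_two]; linarith)
    refine le_trans (le_of_eq ?_) (this.trans ?_)
    · congr 1; ext ω; congr 2; ring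
    · apply ENNReal.ofReal_le_ofReal
      rw [Real.exp_le_exp]
      have : (T : ℝ) ≤ L * T := le_mul_of_one_le_left (by positivity) hL1
      calc 128 * (κ * (2 * θ)) ^ 2 * (T : ℝ) ≤ 128 * (κ * (2 * θ)) ^ 2 * (L * T) := by gcongr
        _ = _ := by ring
  · have hc : ((2 * κ).toNNReal : ℝ) = 2 * κ := Real.coe_toNNReal _ (by positivity)
    have := lintegral_exp_sum_mul_pastSum_le h hm (fun t => (hx t).hasSubgaussianMGF hκ) hL hLT
      (θ := 4 * θ) (by
        rw [hc]
        have : (2 * κ * (4 * θ) * L) ^ 2 = (8 * (|θ| * κ * L)) ^ 2 := by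
          rw [mul_pow, mul_pow, mul_pow, mul_pow, mul_pow, mul_pow, mul_pow, sq_abs]; ring
        rw [this]
        have h0 : 0 ≤ |θ| * κ * L := by positivity
        nlinarith)
    refine le_trans (le_of_eq ?_) (this.trans (le_of_eq ?_))
    · congr 1; ext ω; congr 2; ring
    · rw [hc]; congr 2; ring

theorem measure_abs_bandForm_sub_ge_le (h : iIndepFun x μ) {κ : ℝ} (hκ : 0 < κ)
    (hx : ∀ t, CentredSqExp (x t) κ μ) {L : ℕ} (hL : 1 ≤ L) (hLT : L ≤ T) {s : ℝ} (hs : 0 ≤ s) :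
    μ {ω | 48 * κ * (√(s * L * T) + L * s) ≤ |bandForm L (x · ω) - ∑ t, ∫ ω', x t ω' ^ 2 ∂μ|}
      ≤ 2 * ENNReal.ofReal (Real.exp (-s)) := by
  have hm : ∀ t, Measurable (x t) := fun t => (hx t).measurable
  have hmeas : Measurable fun ω => bandForm L (x · ω) - ∑ t, ∫ ω', x t ω' ^ 2 ∂μ := by
    unfold bandForm
    refine Measurable.sub_const (Finset.measurable_sum Finset.univ fun s _ =>
      Finset.measurable_sum Finset.univ fun t _ => ?_) _
    split_ifs <;> fun_prop
  have hL0 : (0 : ℝ) < L := by exact_mod_cast hL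
  have hT0 : (0 : ℝ) < T := by exact_mod_cast (by omega : 0 < T)
  set τ := 48 * κ * (√(s * L * T) + L * s) with hτ
  -- Chernoff's parameter: of order `√(s / (L T)) / κ` in the Gaussian regime `s L ≤ T`, and the
  -- largest admissible value otherwise.
  obtain ⟨θ, hθ0, hθ1, hθ2⟩ : ∃ θ : ℝ, 0 ≤ θ ∧ 24 * (θ * κ * L) ≤ 1 ∧
      512 * (κ * θ) ^ 2 * (L * T) - θ * τ ≤ -s := by
    rcases le_or_gt (s * L) T with hsT | hsT
    · refine ⟨√(s * L * T) / (24 * κ * (L * T)), by positivity, ?_, ?_⟩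
      · have h1 : √(s * L * T) ≤ T := Real.sqrt_le_iff.2 ⟨hT0.le, by nlinarith⟩
        have h2 : 24 * (√(s * L * T) / (24 * κ * (L * T)) * κ * L) = √(s * L * T) / T := by
          field_simp
        rw [h2, div_le_one hT0]
        exact h1
      · have h3 : √(s * L * T) ^ 2 = s * L * T := Real.sq_sqrt (by positivity)
        set q := √(s * L * T) with hq
        have hq0 : 0 ≤ q := Real.sqrt_nonneg _
        have h4 : 512 * (κ * (q / (24 * κ * (L * T)))) ^ 2 * (L * T) = 512 / 576 * s := by
          field_simp
          rw [h3]; ring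
        have h5 : q / (24 * κ * (L * T)) * τ = 2 * s + 2 * q * s / T := by
          rw [hτ]
          field_simp
          linear_combination 48 * h3
        rw [h4, h5]
        have : 0 ≤ 2 * q * s / T := by positivity
        linarith
    · refine ⟨1 / (24 * κ * L), by positivity, le_of_eq (by field_simp), ?_⟩
      have h4 : 512 * (κ * (1 / (24 * κ * L))) ^ 2 * (L * T) = 512 / 576 * (T / L) := by
        field_simp; norm_num
      have h5 : 1 / (24 * κ * L) * τ = 2 * (√(s * L * T) / L) + 2 * s := by
        rw [hτ]; field_simp; ring
      rw [h4, h5]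
      have h6 : (T : ℝ) / L ≤ s := by rw [div_le_iff₀ hL0]; exact hsT.le
      have : 0 ≤ √(s * L * T) / L := by positivity
      linarith
  have hp := lintegral_exp_bandForm_le h hκ hx hL hLT (θ := θ) (by rwa [abs_of_nonneg hθ0])
  have hn := lintegral_exp_bandForm_le h hκ hx hL hLT (θ := -θ) (by rwa [abs_neg, abs_of_nonneg hθ0])
  have hp' := measure_le_of_lintegral_exp_le (hmeas.const_mul _) hp hθ2
  have hn' := measure_le_of_lintegral_exp_le (hmeas.const_mul _) hn (τ := θ * τ) (s := s)
    (by rw [mul_neg, neg_sq]; exact hθ2)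
  refine (measure_mono ?_).trans ((measure_union_le _ _).trans
    ((add_le_add hp' hn').trans_eq (two_mul _).symm))
  intro ω hω
  rcases le_abs.1 (Set.mem_ofPred_eq ▸ hω : τ ≤ |_|) with h' | h'
  · exact Or.inl (mul_le_mul_of_nonneg_left h' hθ0)
  · refine Or.inr ?_
    have := mul_le_mul_of_nonneg_left h' hθ0
    simp only [Set.mem_ofPred_eq]
    linarith
end

/-! ### Nets and quadratic forms. -/

section Net
variable (F : Type*) [NormedAddCommGroup F] [NormedSpace ℝ F] [FiniteDimensional ℝ F]

/-- A maximal 1-separated subset of the ball of radius `2`, scaled by `1/2`: maximality gives the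
covering, and the Besicovitch packing bound gives the cardinality. -/
theorem exists_finset_half_net : ∃ N : Finset F, N.card ≤ 5 ^ Module.finrank ℝ F ∧
    (∀ n ∈ N, ‖n‖ ≤ 1) ∧ ∀ x : F, ‖x‖ ≤ 1 → ∃ n ∈ N, ‖x - n‖ ≤ 1 / 2 := by
  classical
  let P : Finset F → Prop := fun s => (∀ c ∈ s, ‖c‖ ≤ 2) ∧ ∀ c ∈ s, ∀ d ∈ s, c ≠ d → 1 ≤ ‖c - d‖
  let S : Set ℕ := {k | ∃ s : Finset F, P s ∧ s.card = k}
  have hS : S.Nonempty := ⟨0, ∅, by simp [P], by simp⟩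
  have hb : BddAbove S := ⟨5 ^ Module.finrank ℝ F, by
    rintro k ⟨s, hs, rfl⟩
    exact Besicovitch.card_le_of_separated s hs.1 hs.2⟩
  obtain ⟨s, hs, hcard⟩ := Nat.sSup_mem hS hb
  have hmax : ∀ s' : Finset F, P s' → s'.card ≤ s.card := fun s' h' => by
    rw [hcard]; exact le_csSup hb ⟨s', h', rfl⟩
  have hhalf : ∀ w : F, ‖(1 / 2 : ℝ) • w‖ = ‖w‖ / 2 := fun w => by
    rw [norm_smul]; norm_num; ring
  refine ⟨s.image fun c => (1 / 2 : ℝ) • c,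
    Finset.card_image_le.trans (Besicovitch.card_le_of_separated s hs.1 hs.2), ?_, ?_⟩
  · intro n hn
    obtain ⟨c, hc, rfl⟩ := Finset.mem_image.1 hn
    rw [hhalf]
    linarith [hs.1 c hc]
  · intro x hx
    by_contra! hcon
    have hfar : ∀ c ∈ s, 1 < ‖(2 : ℝ) • x - c‖ := fun c hc => by
      have h1 := hcon _ (Finset.mem_image_of_mem _ hc)
      have h2 : x - (1 / 2 : ℝ) • c = (1 / 2 : ℝ) • ((2 : ℝ) • x - c) := by
        rw [smul_sub, smul_smul]; norm_num
      rw [h2, hhalf] at h1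
      linarith
    have hnot : (2 : ℝ) • x ∉ s := fun hmem => by
      have := hfar _ hmem
      rw [sub_self, norm_zero] at this
      linarith
    have := hmax (insert ((2 : ℝ) • x) s) ⟨?_, ?_⟩
    · rw [Finset.card_insert_of_notMem hnot] at this
      omega
    · intro c hc
      rcases Finset.mem_insert.1 hc with rfl | hc
      · rw [norm_smul]; norm_num; linarith
      · exact hs.1 c hc
    · intro c hc d hd hcd
      rcases Finset.mem_insert.1 hc with hc | hc <;> rcases Finset.mem_insert.1 hd with hd | hd
      · exact absurd (hc.trans hd.symm) hcd
      · rw [hc]; exact (hfar d hd).le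
      · rw [hd, norm_sub_rev]; exact (hfar c hc).le
      · exact hs.2 c hc d hd hcd

variable {F}

theorem abs_linearMap_le_of_half_net {N : Finset F}
    (hN : ∀ x : F, ‖x‖ ≤ 1 → ∃ n ∈ N, ‖x - n‖ ≤ 1 / 2) (f : F →ₗ[ℝ] ℝ) {ε : ℝ}
    (hf : ∀ n ∈ N, |f n| ≤ ε) (x : F) : |f x| ≤ 2 * ε * ‖x‖ := by
  obtain ⟨n₀, hn₀, -⟩ := hN 0 (by simp)
  have hε : 0 ≤ ε := (abs_nonneg _).trans (hf n₀ hn₀)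
  let g : F →L[ℝ] ℝ := LinearMap.toContinuousLinearMap f
  have hg : ‖g‖ ≤ ε + ‖g‖ / 2 := by
    refine ContinuousLinearMap.opNorm_le_of_unit_norm (by positivity) fun y hy => ?_
    obtain ⟨n, hn, hyn⟩ := hN y hy.le
    have h1 : g y = g n + g (y - n) := by rw [← map_add]; congr 1; abel
    have h2 : ‖g (y - n)‖ ≤ ‖g‖ * (1 / 2) := (g.le_opNorm _).trans (by gcongr)
    have h3 : ‖g n‖ ≤ ε := hf n hn
    rw [h1]
    exact (norm_add_le _ _).trans (by linarith)
  calc |f x| = ‖g x‖ := rfl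
    _ ≤ ‖g‖ * ‖x‖ := g.le_opNorm x
    _ ≤ 2 * ε * ‖x‖ := by gcongr; linarith

variable (F) in
/-- A symmetric bilinear form on a finite-dimensional space is controlled, up to a factor `8`, by
its values on the diagonal at exponentially many points of the unit ball. -/
theorem exists_finset_control_quadratic : ∃ Z : Finset F, Z.card ≤ 2 * 25 ^ Module.finrank ℝ F ∧
    (∀ z ∈ Z, ‖z‖ ≤ 1) ∧ ∀ (B : F →ₗ[ℝ] F →ₗ[ℝ] ℝ), (∀ x y, B x y = B y x) → ∀ ε : ℝ,
      (∀ z ∈ Z, |B z z| ≤ ε) → ∀ z, |B z z| ≤ 8 * ε * ‖z‖ ^ 2 := by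
  classical
  obtain ⟨N, hcard, hN1, hN⟩ := exists_finset_half_net F
  let e : F × F → F := fun p => (1 / 2 : ℝ) • (p.1 + p.2)
  let e' : F × F → F := fun p => (1 / 2 : ℝ) • (p.1 - p.2)
  -- Half-sums and half-differences of net points, so that polarization recovers `B` on pairs of net
  -- points. The factor `8` is `2` from polarization and `2` from the net argument in each variable.
  refine ⟨(N ×ˢ N).image e ∪ (N ×ˢ N).image e', ?_, ?_, ?_⟩
  · calc _ ≤ _ := Finset.card_union_le _ _
      _ ≤ (N ×ˢ N).card + (N ×ˢ N).card := add_le_add Finset.card_image_le Finset.card_image_le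
      _ = 2 * (N.card * N.card) := by rw [Finset.card_product]; ring
      _ ≤ 2 * (5 ^ Module.finrank ℝ F * 5 ^ Module.finrank ℝ F) := by gcongr
      _ = _ := by rw [← mul_pow]; norm_num
  · intro z hz
    rcases Finset.mem_union.1 hz with hz | hz <;>
      obtain ⟨⟨x, y⟩, hxy, rfl⟩ := Finset.mem_image.1 hz <;>
      obtain ⟨hx, hy⟩ := Finset.mem_product.1 hxy <;>
      have h1 := hN1 _ hx <;> have h2 := hN1 _ hy <;> simp only at h1 h2
    · have := norm_add_le x y
      simp only [e, norm_smul]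
      norm_num
      linarith
    · have := norm_sub_le x y
      simp only [e', norm_smul]
      norm_num
      linarith
  · intro B hB ε hε z
    have hNN : ∀ x ∈ N, ∀ y ∈ N, |B x y| ≤ 2 * ε := by
      intro x hx y hy
      have h1 := hε (e (x, y)) (Finset.mem_union_left _
        (Finset.mem_image_of_mem _ (Finset.mk_mem_product hx hy)))
      have h2 := hε (e' (x, y)) (Finset.mem_union_right _
        (Finset.mem_image_of_mem _ (Finset.mk_mem_product hx hy)))
      have h3 : B x y = B (e (x, y)) (e (x, y)) - B (e' (x, y)) (e' (x, y)) := by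
        simp only [e, e', map_add, map_sub, map_smul, LinearMap.add_apply, LinearMap.sub_apply,
          LinearMap.smul_apply, smul_eq_mul, hB y x]
        ring
      rw [h3]
      exact (abs_sub _ _).trans (by linarith)
    have h1 : ∀ x ∈ N, |B x z| ≤ 2 * (2 * ε) * ‖z‖ := fun x hx =>
      abs_linearMap_le_of_half_net hN (B x) (hNN x hx) z
    have h2 := abs_linearMap_le_of_half_net hN (B.flip z) (fun n hn => h1 n hn) z
    calc |B z z| ≤ _ := h2
      _ = _ := by ring
end Net

/-! ### Discrete Fourier analysis of the convolution. -/

section Fourier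

theorem sum_cos_two_pi_mul_div {N : ℕ} (hN : 0 < N) (n : ℤ) :
    ∑ m ∈ Finset.range N, Real.cos (2 * Real.pi * m / N * n) = if (N : ℤ) ∣ n then (N : ℝ) else 0 := by
  have hN0 : (N : ℂ) ≠ 0 := by exact_mod_cast hN.ne'
  have hζ := Complex.isPrimitiveRoot_exp N hN.ne'
  set ζ := Complex.exp (2 * Real.pi * Complex.I / N) with hζd
  have e : ∀ m : ℕ, Real.cos (2 * Real.pi * m / N * n) = ((ζ ^ n) ^ m).re := by
    intro m
    rw [← zpow_natCast, ← zpow_mul, hζd, ← Complex.exp_int_mul]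
    have : ((n * (m : ℤ) : ℤ) : ℂ) * (2 * Real.pi * Complex.I / N)
        = ((2 * Real.pi * m / N * n : ℝ) : ℂ) * Complex.I := by
      push_cast; ring
    rw [this, Complex.exp_ofReal_mul_I_re]
  simp_rw [e]
  rw [← Complex.re_sum]
  split_ifs with h
  · have : ζ ^ n = 1 := (hζ.zpow_eq_one_iff_dvd n).2 h
    simp [this]
  · have h1 : ζ ^ n ≠ 1 := fun h' => h ((hζ.zpow_eq_one_iff_dvd n).1 h')
    have h2 : (ζ ^ n) ^ N = 1 := by
      rw [← zpow_natCast, ← zpow_mul, mul_comm, zpow_mul, zpow_natCast, hζ.pow_eq_one, one_zpow]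
    rw [geom_sum_eq h1, h2]
    simp

/-- No aliasing: the only multiple of `2 * L + 1` in this range is `0`. -/
theorem sum_cos_of_lt {L : ℕ} {n : ℤ} (hn : |n| ≤ 2 * L) :
    ∑ m ∈ Finset.range (2 * L + 1), Real.cos (2 * Real.pi * m / (2 * L + 1 : ℕ) * n)
      = if n = 0 then ((2 * L + 1 : ℕ) : ℝ) else 0 := by
  rw [sum_cos_two_pi_mul_div (by omega)]
  refine if_congr ⟨fun h => ?_, fun h => by simp [h]⟩ rfl rfl
  refine Int.eq_zero_of_abs_lt_dvd h ?_
  push_cast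
  omega

/-- The squared norm of the full convolution of the array `f`. -/
def convSq {T L : ℕ} (f : Fin T → Fin (L + 1) → ℝ) : ℝ :=
  ∑ i ∈ Finset.range (T + L), (∑ s : Fin T, ∑ j : Fin (L + 1),
    if s.val + j.val = i then f s j else 0) ^ 2

theorem convSq_eq {T L : ℕ} (f : Fin T → Fin (L + 1) → ℝ) :
    convSq f = ∑ s, ∑ t, ∑ j, ∑ k, if s.val + j.val = t.val + k.val then f s j * f t k else 0 := by
  have h : ∀ i, (∑ s : Fin T, ∑ j : Fin (L + 1), if s.val + j.val = i then f s j else 0) ^ 2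
      = ∑ s, ∑ t, ∑ j, ∑ k, (if s.val + j.val = i then f s j else 0) *
        (if t.val + k.val = i then f t k else 0) := by
    intro i
    rw [sq, Finset.sum_mul_sum]
    simp_rw [Finset.sum_mul_sum]
  unfold convSq
  simp_rw [h]
  rw [Finset.sum_comm]
  refine Finset.sum_congr rfl fun s _ => ?_
  rw [Finset.sum_comm]
  refine Finset.sum_congr rfl fun t _ => ?_
  rw [Finset.sum_comm]
  refine Finset.sum_congr rfl fun j _ => ?_
  rw [Finset.sum_comm]
  refine Finset.sum_congr rfl fun k _ => ?_
  have hs : s.val + j.val ∈ Finset.range (T + L) := by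
    rw [Finset.mem_range]; omega
  rw [Finset.sum_eq_single_of_mem _ hs (fun i _ hi => by rw [if_neg (Ne.symm hi), zero_mul])]
  rw [if_pos rfl]
  by_cases h : s.val + j.val = t.val + k.val
  · simp [h]
  · simp [h, Ne.symm h]

/-- Averaging over frequencies extracts the pairs with `s + j = t + k`. These satisfy `|s - t| ≤ L`
automatically, so the band restriction loses nothing, while it keeps `|s + j - t - k| ≤ 2L` so that
`2 * L + 1` frequencies suffice. -/
theorem sum_bandForm_fourier {T L : ℕ} (f : Fin T → Fin (L + 1) → ℝ) :
    ∑ m ∈ Finset.range (2 * L + 1),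
      (bandForm L (fun s : Fin T => ∑ j : Fin (L + 1),
        Real.cos (2 * Real.pi * m / (2 * L + 1 : ℕ) * (s + j)) * f s j)
      + bandForm L (fun s : Fin T => ∑ j : Fin (L + 1),
        Real.sin (2 * Real.pi * m / (2 * L + 1 : ℕ) * (s + j)) * f s j))
      = (2 * L + 1 : ℕ) * convSq f := by
  have h1 : ∀ m : ℕ,
      bandForm L (fun s : Fin T => ∑ j : Fin (L + 1),
        Real.cos (2 * Real.pi * m / (2 * L + 1 : ℕ) * (s + j)) * f s j)
      + bandForm L (fun s : Fin T => ∑ j : Fin (L + 1),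
        Real.sin (2 * Real.pi * m / (2 * L + 1 : ℕ) * (s + j)) * f s j)
      = ∑ s : Fin T, ∑ t : Fin T, ∑ j : Fin (L + 1), ∑ k : Fin (L + 1),
        if s.val ≤ t + L ∧ t.val ≤ s + L then Real.cos (2 * Real.pi * m / (2 * L + 1 : ℕ) *
          ((s + j - (t + k) : ℤ) : ℝ)) * (f s j * f t k) else 0 := by
    intro m
    unfold bandForm
    rw [← Finset.sum_add_distrib]
    refine Finset.sum_congr rfl fun s _ => ?_
    rw [← Finset.sum_add_distrib]
    refine Finset.sum_congr rfl fun t _ => ?_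
    split_ifs
    · rw [Finset.sum_mul_sum, Finset.sum_mul_sum, ← Finset.sum_add_distrib]
      refine Finset.sum_congr rfl fun j _ => ?_
      rw [← Finset.sum_add_distrib]
      refine Finset.sum_congr rfl fun k _ => ?_
      push_cast
      rw [mul_sub, Real.cos_sub]
      ring
    · simp
  simp_rw [h1]
  rw [convSq_eq, Finset.mul_sum, Finset.sum_comm]
  refine Finset.sum_congr rfl fun s _ => ?_
  rw [Finset.mul_sum, Finset.sum_comm]
  refine Finset.sum_congr rfl fun t _ => ?_
  rw [Finset.mul_sum, Finset.sum_comm]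
  refine Finset.sum_congr rfl fun j _ => ?_
  rw [Finset.mul_sum, Finset.sum_comm]
  refine Finset.sum_congr rfl fun k _ => ?_
  by_cases hb : s.val ≤ t + L ∧ t.val ≤ s + L
  · simp only [if_pos hb]
    rw [← Finset.sum_mul, sum_cos_of_lt (by rw [abs_le]; omega)]
    have : ((s : ℤ) + j - (t + k) = 0) ↔ s.val + j.val = t.val + k.val := by omega
    simp only [this]
    split_ifs <;> simp
  -- Outside the band `s + j = t + k` is impossible because `j, k ≤ L`.
  · simp only [if_neg hb, Finset.sum_const_zero]
    rw [if_neg (by omega), mul_zero]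

/-- Parseval's identity, with real and imaginary parts written separately. -/
theorem sum_norm_sq_fourier {E : Type*} [NormedAddCommGroup E] [InnerProductSpace ℝ E] {L : ℕ}
    (v : Fin (L + 1) → E) :
    ∑ m ∈ Finset.range (2 * L + 1),
      (‖∑ j : Fin (L + 1), Real.cos (2 * Real.pi * m / (2 * L + 1 : ℕ) * j) • v j‖ ^ 2
      + ‖∑ j : Fin (L + 1), Real.sin (2 * Real.pi * m / (2 * L + 1 : ℕ) * j) • v j‖ ^ 2)
      = (2 * L + 1 : ℕ) * ∑ j, ‖v j‖ ^ 2 := by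
  have h1 : ∀ m : ℕ,
      ‖∑ j : Fin (L + 1), Real.cos (2 * Real.pi * m / (2 * L + 1 : ℕ) * j) • v j‖ ^ 2
      + ‖∑ j : Fin (L + 1), Real.sin (2 * Real.pi * m / (2 * L + 1 : ℕ) * j) • v j‖ ^ 2
      = ∑ j : Fin (L + 1), ∑ k : Fin (L + 1),
        Real.cos (2 * Real.pi * m / (2 * L + 1 : ℕ) * ((j - k : ℤ) : ℝ)) * ⟪v j, v k⟫ := by
    intro m
    rw [← real_inner_self_eq_norm_sq, ← real_inner_self_eq_norm_sq]
    simp_rw [sum_inner, inner_sum, real_inner_smul_left, real_inner_smul_right]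
    rw [← Finset.sum_add_distrib]
    refine Finset.sum_congr rfl fun j _ => ?_
    rw [← Finset.sum_add_distrib]
    refine Finset.sum_congr rfl fun k _ => ?_
    push_cast
    rw [mul_sub, Real.cos_sub]
    ring
  simp_rw [h1]
  rw [Finset.mul_sum, Finset.sum_comm]
  refine Finset.sum_congr rfl fun j _ => ?_
  rw [Finset.sum_comm]
  have h2 : ∀ k : Fin (L + 1), ∑ m ∈ Finset.range (2 * L + 1),
      Real.cos (2 * Real.pi * m / (2 * L + 1 : ℕ) * ((j - k : ℤ) : ℝ)) * ⟪v j, v k⟫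
      = if j = k then (2 * L + 1 : ℕ) * ‖v j‖ ^ 2 else 0 := by
    intro k
    rw [← Finset.sum_mul, sum_cos_of_lt (by rw [abs_le]; omega)]
    have : ((j : ℤ) - k = 0) ↔ j = k := by rw [Fin.ext_iff]; omega
    simp only [this]
    split_ifs with h
    · rw [← h, real_inner_self_eq_norm_sq]
    · simp
  simp_rw [h2]
  simp
end Fourier

/-! ### From the sub-gaussian norm and isotropy to scalar marginals. -/

section
variable {Ω : Type*} [MeasurableSpace Ω] {μ : Measure Ω}

theorem one_le_of_lintegral_exp_sub_one_le {X : Ω → ℝ} {s : ℝ} (hs : 0 < s)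
    (hX2 : ∫ ω, X ω ^ 2 ∂μ = 1)
    (h : ∫⁻ ω, ENNReal.ofReal (Real.exp ((X ω / s) ^ 2) - 1) ∂μ ≤ 1) : 1 ≤ s := by
  -- A non-integrable function would have integral `0` by convention, contradicting the value `1`.
  have hint : Integrable (fun ω => X ω ^ 2) μ := by
    by_contra hn
    rw [integral_undef hn] at hX2
    norm_num at hX2
  have h1 : ENNReal.ofReal (1 / s ^ 2) ≤ 1 := by
    calc ENNReal.ofReal (1 / s ^ 2) = ENNReal.ofReal (∫ ω, X ω ^ 2 / s ^ 2 ∂μ) := by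
          rw [integral_div, hX2]
      _ = ∫⁻ ω, ENNReal.ofReal (X ω ^ 2 / s ^ 2) ∂μ :=
          ofReal_integral_eq_lintegral_ofReal (hint.div_const _)
            (Filter.Eventually.of_forall fun ω => by positivity)
      _ ≤ _ := lintegral_mono fun ω => ENNReal.ofReal_le_ofReal (by
          rw [div_pow]
          linarith [Real.add_one_le_exp (X ω ^ 2 / s ^ 2)])
      _ ≤ 1 := h
  rw [ENNReal.ofReal_le_one, div_le_one (by positivity)] at h1
  nlinarith

theorem exists_of_psi2Norm_lt {X : Ω → ℝ} {r : ℝ} (h : psi2Norm μ X < ENNReal.ofReal r) :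
    ∃ s : ℝ, 0 < s ∧ s < r ∧ ∫⁻ ω, ENNReal.ofReal (Real.exp ((X ω / s) ^ 2) - 1) ∂μ ≤ 1 := by
  obtain ⟨_, ⟨s, hs, rfl, hle⟩, hlt⟩ := sInf_lt_iff.1 h
  exact ⟨s, hs, ((ENNReal.ofReal_lt_ofReal_iff_of_nonneg hs.le).1 hlt), hle⟩

variable {d : ℕ} {u : Ω → EuclideanSpace ℝ (Fin d)}

theorem IsIsotropic.memLp_apply (hm : Measurable u) (h : IsIsotropic μ u) (i : Fin d) :
    MemLp (fun ω => u ω i) 2 μ := by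
  rw [memLp_two_iff_integrable_sq (by fun_prop)]
  by_contra hn
  have := h i i
  simp_rw [← sq] at this
  rw [integral_undef hn] at this
  simp at this

theorem IsIsotropic.integral_inner_sq (hm : Measurable u) (h : IsIsotropic μ u)
    (c : EuclideanSpace ℝ (Fin d)) : ∫ ω, ⟪u ω, c⟫ ^ 2 ∂μ = ‖c‖ ^ 2 := by
  have e : ∀ ω, ⟪u ω, c⟫ ^ 2 = ∑ i, ∑ j, c i * c j * (u ω i * u ω j) := by
    intro ω
    rw [PiLp.inner_apply, sq, Finset.sum_mul_sum]
    refine Finset.sum_congr rfl fun i _ => Finset.sum_congr rfl fun j _ => ?_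
    simp only [RCLike.inner_apply, conj_trivial]
    ring
  have hint : ∀ i j, Integrable (fun ω => c i * c j * (u ω i * u ω j)) μ := fun i j =>
    ((h.memLp_apply hm i).integrable_mul (h.memLp_apply hm j)).const_mul _
  simp_rw [e]
  rw [integral_finsetSum _ fun i _ => integrable_finsetSum _ fun j _ => hint i j]
  simp_rw [integral_finsetSum _ fun j _ => hint _ j, integral_const_mul, h _ _, Matrix.one_apply]
  rw [EuclideanSpace.norm_sq_eq]
  simp [← sq]

theorem IsSubGaussianVec.psi2Norm_le {K : ℝ≥0} (h : IsSubGaussianVec μ u K)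
    {v : EuclideanSpace ℝ (Fin d)} (hv : ‖v‖ = 1) : psi2Norm μ (fun ω => ⟪u ω, v⟫) ≤ K :=
  (le_iSup₂ (f := fun v (_ : v ∈ Metric.sphere (0 : EuclideanSpace ℝ (Fin d)) 1) =>
    psi2Norm μ (fun ω => ⟪u ω, v⟫)) v (by simp [hv])).trans h

theorem one_le_of_psi2Norm_le {X : Ω → ℝ} {K : ℝ≥0} (hX2 : ∫ ω, X ω ^ 2 ∂μ = 1)
    (h : psi2Norm μ X ≤ K) : 1 ≤ (K : ℝ) := by
  refine le_of_forall_pos_le_add fun ε hε => ?_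
  have h1 : psi2Norm μ X < ENNReal.ofReal (K + ε) := by
    refine h.trans_lt ?_
    rw [← ENNReal.ofReal_coe_nnreal]
    exact (ENNReal.ofReal_lt_ofReal_iff (by positivity)).2 (by linarith)
  obtain ⟨s, hs, hsr, hle⟩ := exists_of_psi2Norm_lt h1
  linarith [one_le_of_lintegral_exp_sub_one_le hs hX2 hle]

/-- Since `K < 2 * K`, some admissible scale lies below `2 * K`; the slack avoids asking whether the
infimum is attained. -/
theorem exp_sq_div_of_psi2Norm_le [IsProbabilityMeasure μ] {X : Ω → ℝ} {K : ℝ≥0} (hX : Measurable X)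
    (hK : 1 ≤ (K : ℝ)) (h : psi2Norm μ X ≤ K) :
    Integrable (fun ω => Real.exp (X ω ^ 2 / (4 * K ^ 2))) μ ∧
      ∫ ω, Real.exp (X ω ^ 2 / (4 * K ^ 2)) ∂μ ≤ 2 := by
  have h1 : psi2Norm μ X < ENNReal.ofReal (2 * K) := by
    refine h.trans_lt ?_
    rw [← ENNReal.ofReal_coe_nnreal]
    exact (ENNReal.ofReal_lt_ofReal_iff (by positivity)).2 (by linarith)
  obtain ⟨s, hs, hsr, hle⟩ := exists_of_psi2Norm_lt h1
  have hpt : ∀ ω, Real.exp (X ω ^ 2 / (4 * K ^ 2)) ≤ Real.exp ((X ω / s) ^ 2) := fun ω => by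
    rw [Real.exp_le_exp, div_pow]
    gcongr
    nlinarith
  have h2 : ∫⁻ ω, ENNReal.ofReal (Real.exp (X ω ^ 2 / (4 * K ^ 2))) ∂μ ≤ 2 := by
    calc _ ≤ ∫⁻ ω, (ENNReal.ofReal (Real.exp ((X ω / s) ^ 2) - 1) + 1) ∂μ := by
          refine lintegral_mono fun ω => ?_
          rw [← ENNReal.ofReal_one, ← ENNReal.ofReal_add _ zero_le_one, sub_add_cancel]
          · exact ENNReal.ofReal_le_ofReal (hpt ω)
          · linarith [Real.add_one_le_exp ((X ω / s) ^ 2), sq_nonneg (X ω / s)]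
      _ = ∫⁻ ω, ENNReal.ofReal (Real.exp ((X ω / s) ^ 2) - 1) ∂μ + 1 := by
          rw [lintegral_add_right _ measurable_const]; simp
      _ ≤ 1 + 1 := by gcongr
      _ = 2 := by norm_num
  have hnn : 0 ≤ᵐ[μ] fun ω => Real.exp (X ω ^ 2 / (4 * K ^ 2)) :=
    Filter.Eventually.of_forall fun ω => (Real.exp_pos _).le
  have hint : Integrable (fun ω => Real.exp (X ω ^ 2 / (4 * K ^ 2))) μ :=
    (lintegral_ofReal_ne_top_iff_integrable (by fun_prop) hnn).1
      (h2.trans_lt (by norm_num)).ne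
  refine ⟨hint, ?_⟩
  rw [← ofReal_integral_eq_lintegral_ofReal hint hnn] at h2
  have h3 : (2 : ℝ≥0∞) = ENNReal.ofReal 2 := by norm_num
  rw [h3] at h2
  exact (ENNReal.ofReal_le_ofReal_iff (by norm_num)).1 h2

/-- A coordinate has second moment `1`, and `y ≤ exp y - 1` bounds every admissible scale below by
`1`. This later lets `K ^ 2` absorb terms free of `K`. -/
theorem IsSubGaussianVec.one_le {K : ℝ≥0} (hd : 1 ≤ d) (hm : Measurable u) (hI : IsIsotropic μ u)
    (h : IsSubGaussianVec μ u K) : 1 ≤ (K : ℝ) := by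
  have hv : ‖EuclideanSpace.single (⟨0, hd⟩ : Fin d) (1 : ℝ)‖ = 1 := by simp
  refine one_le_of_psi2Norm_le ?_ (h.psi2Norm_le hv)
  rw [hI.integral_inner_sq hm, hv, one_pow]

variable [IsProbabilityMeasure μ]

theorem IsIsotropic.integrable (hm : Measurable u) (h : IsIsotropic μ u) : Integrable u μ := by
  have h1 : Integrable (fun ω => ∑ i, u ω i ^ 2) μ :=
    integrable_finsetSum _ fun i _ => (h.memLp_apply hm i).integrable_sq
  refine (h1.add (integrable_const 1)).mono' hm.aestronglyMeasurable
    (Filter.Eventually.of_forall fun ω => ?_)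
  have h2 : ‖u ω‖ ^ 2 = ∑ i, u ω i ^ 2 := by simp [EuclideanSpace.norm_sq_eq]
  simp only [Pi.add_apply]
  rw [← h2]
  nlinarith [sq_nonneg (‖u ω‖ - 1), sq_nonneg ‖u ω‖]

theorem IsSubGaussianVec.centredSqExp_inner {K : ℝ≥0} (hK : 1 ≤ (K : ℝ)) (hm : Measurable u)
    (h0 : ∫ ω, u ω ∂μ = 0) (hI : IsIsotropic μ u) (h : IsSubGaussianVec μ u K)
    {c : EuclideanSpace ℝ (Fin d)} (hc : ‖c‖ ≤ 1) :
    CentredSqExp (fun ω => ⟪u ω, c⟫) (4 * K ^ 2) μ := by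
  have hmc : Measurable fun ω => ⟪u ω, c⟫ := by fun_prop
  have hexp : Integrable (fun ω => Real.exp (⟪u ω, c⟫ ^ 2 / (4 * K ^ 2))) μ ∧
      ∫ ω, Real.exp (⟪u ω, c⟫ ^ 2 / (4 * K ^ 2)) ∂μ ≤ 2 := by
    rcases eq_or_ne c 0 with rfl | hc0
    · simp
    · have hc1 : 0 < ‖c‖ := norm_pos_iff.2 hc0
      set v := ‖c‖⁻¹ • c with hv
      have hv1 : ‖v‖ = 1 := by rw [hv, norm_smul, norm_inv, norm_norm, inv_mul_cancel₀ hc1.ne']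
      obtain ⟨hi, hle⟩ := exp_sq_div_of_psi2Norm_le (by fun_prop) hK (h.psi2Norm_le hv1)
      have hpt : ∀ ω, Real.exp (⟪u ω, c⟫ ^ 2 / (4 * K ^ 2))
          ≤ Real.exp (⟪u ω, v⟫ ^ 2 / (4 * K ^ 2)) := fun ω => by
        have e : c = ‖c‖ • v := by rw [hv, smul_smul, mul_inv_cancel₀ hc1.ne', one_smul]
        rw [Real.exp_le_exp]
        nth_rw 1 [e]
        rw [real_inner_smul_right, mul_pow]
        gcongr
        exact mul_le_of_le_one_left (sq_nonneg _) (pow_le_one₀ hc1.le hc)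
      have hi' : Integrable (fun ω => Real.exp (⟪u ω, c⟫ ^ 2 / (4 * K ^ 2))) μ :=
        hi.mono' (by fun_prop) (Filter.Eventually.of_forall fun ω => by
          rw [Real.norm_of_nonneg (Real.exp_pos _).le]; exact hpt ω)
      exact ⟨hi', (integral_mono hi' hi hpt).trans hle⟩
  refine ⟨hmc, ?_, hexp.1, hexp.2⟩
  simp_rw [real_inner_comm c]
  rw [integral_inner (hI.integrable hm), h0, inner_zero_right]
end

/-! ### The symbol at one frequency, with complex vectors as real pairs. -/

section
variable {E : Type*} [NormedAddCommGroup E] [InnerProductSpace ℝ E]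

/-- The real part of `e^{iφ} (a + i b)` for `z = (a, b)`. -/
noncomputable def rotatedPart (φ : ℝ) : WithLp 2 (E × E) →ₗ[ℝ] E :=
  Real.cos φ • WithLp.fstₗ 2 ℝ E E - Real.sin φ • WithLp.sndₗ 2 ℝ E E

theorem rotatedPart_apply (φ : ℝ) (z : WithLp 2 (E × E)) :
    rotatedPart φ z = Real.cos φ • z.fst - Real.sin φ • z.snd := rfl

theorem rotatedPart_sub_pi_div_two (φ : ℝ) (z : WithLp 2 (E × E)) :
    rotatedPart (φ - Real.pi / 2) z = Real.sin φ • z.fst + Real.cos φ • z.snd := by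
  rw [rotatedPart_apply, Real.cos_sub_pi_div_two, Real.sin_sub_pi_div_two, neg_smul, sub_neg_eq_add]

/-- The phase `φ - π / 2` turns the real part into the imaginary part, and rotation preserves the
modulus. By isotropy this makes the two band forms at one frequency have total mean `T ‖z‖²`. -/
theorem norm_rotatedPart_sq_add (φ : ℝ) (z : WithLp 2 (E × E)) :
    ‖rotatedPart φ z‖ ^ 2 + ‖rotatedPart (φ - Real.pi / 2) z‖ ^ 2 = ‖z‖ ^ 2 := by
  rw [rotatedPart_sub_pi_div_two, rotatedPart_apply, norm_sub_sq_real, norm_add_sq_real,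
    WithLp.prod_norm_sq_eq_of_L2]
  simp only [norm_smul, real_inner_smul_left, real_inner_smul_right, Real.norm_eq_abs, mul_pow,
    sq_abs]
  linear_combination (‖z.fst‖ ^ 2 + ‖z.snd‖ ^ 2) * Real.sin_sq_add_cos_sq φ

theorem norm_rotatedPart_le (φ : ℝ) (z : WithLp 2 (E × E)) : ‖rotatedPart φ z‖ ≤ ‖z‖ := by
  refine le_of_sq_le_sq ?_ (norm_nonneg _)
  rw [← norm_rotatedPart_sq_add φ z]
  linarith [sq_nonneg ‖rotatedPart (φ - Real.pi / 2) z‖]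

/-- The pairings of the vectors `w t` with the rotated parts of `z`. -/
noncomputable def phasedPairing {T : ℕ} (w : Fin T → E) (φ : Fin T → ℝ) :
    WithLp 2 (E × E) →ₗ[ℝ] (Fin T → ℝ) :=
  LinearMap.pi fun t => innerₗ E (w t) ∘ₗ rotatedPart (φ t)

theorem phasedPairing_apply {T : ℕ} (w : Fin T → E) (φ : Fin T → ℝ) (z : WithLp 2 (E × E))
    (t : Fin T) : phasedPairing w φ z t = ⟪w t, rotatedPart (φ t) z⟫ := rfl

/-- The symmetric bilinear form whose diagonal is `bandForm`. -/
noncomputable def bandBilin (T L : ℕ) : (Fin T → ℝ) →ₗ[ℝ] (Fin T → ℝ) →ₗ[ℝ] ℝ :=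
  Matrix.toBilin' (Matrix.of fun s t : Fin T => if s.val ≤ t + L ∧ t.val ≤ s + L then (1 : ℝ) else 0)

theorem bandBilin_self (T L : ℕ) (x : Fin T → ℝ) : bandBilin T L x x = bandForm L x := by
  rw [bandBilin, Matrix.toBilin'_apply, bandForm]
  refine Finset.sum_congr rfl fun s _ => Finset.sum_congr rfl fun t _ => ?_
  rw [Matrix.of_apply]
  split_ifs <;> simp

theorem bandBilin_comm (T L : ℕ) (x y : Fin T → ℝ) : bandBilin T L x y = bandBilin T L y x := by
  rw [bandBilin, Matrix.toBilin'_apply, Matrix.toBilin'_apply, Finset.sum_comm]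
  refine Finset.sum_congr rfl fun s _ => Finset.sum_congr rfl fun t _ => ?_
  rw [Matrix.of_apply, Matrix.of_apply]
  split_ifs <;> first | ring1 | tauto

/-- The centred symbol of the block Toeplitz form of `w` at one frequency, as a real bilinear form
on pairs (real part, imaginary part). -/
noncomputable def symbolForm {T : ℕ} (L : ℕ) (w : Fin T → E) (φ : Fin T → ℝ) :
    WithLp 2 (E × E) →ₗ[ℝ] WithLp 2 (E × E) →ₗ[ℝ] ℝ :=
  (bandBilin T L).compl₁₂ (phasedPairing w φ) (phasedPairing w φ)
    + (bandBilin T L).compl₁₂ (phasedPairing w fun t => φ t - Real.pi / 2)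
        (phasedPairing w fun t => φ t - Real.pi / 2)
    - (T : ℝ) • innerₗ (WithLp 2 (E × E))

theorem symbolForm_comm {T : ℕ} (L : ℕ) (w : Fin T → E) (φ : Fin T → ℝ)
    (x y : WithLp 2 (E × E)) : symbolForm L w φ x y = symbolForm L w φ y x := by
  simp only [symbolForm, LinearMap.sub_apply, LinearMap.add_apply, LinearMap.compl₁₂_apply,
    LinearMap.smul_apply, innerₗ_apply_apply]
  rw [bandBilin_comm, bandBilin_comm T L (phasedPairing w _ x), real_inner_comm]

theorem symbolForm_self {T : ℕ} (L : ℕ) (w : Fin T → E) (φ : Fin T → ℝ) (z : WithLp 2 (E × E)) :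
    symbolForm L w φ z z = bandForm L (phasedPairing w φ z)
      + bandForm L (phasedPairing w (fun t => φ t - Real.pi / 2) z) - T * ‖z‖ ^ 2 := by
  simp only [symbolForm, LinearMap.sub_apply, LinearMap.add_apply, LinearMap.compl₁₂_apply,
    LinearMap.smul_apply, innerₗ_apply_apply, bandBilin_self, real_inner_self_eq_norm_sq, smul_eq_mul]

/-- If all symbols at the frequencies `2πm/(2L+1)` are small, so is the centred block Toeplitz
form. -/
theorem abs_convSq_sub_le_of_symbolForm {T L : ℕ} (w : Fin T → E) {ε : ℝ}
    (h : ∀ m ∈ Finset.range (2 * L + 1), ∀ z, |symbolForm L w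
      (fun t => 2 * Real.pi * m / (2 * L + 1 : ℕ) * t) z z| ≤ ε * ‖z‖ ^ 2) (v : Fin (L + 1) → E) :
    |convSq (fun s j => ⟪w s, v j⟫) - T * ∑ j, ‖v j‖ ^ 2| ≤ ε * ∑ j, ‖v j‖ ^ 2 := by
  let z : ℕ → WithLp 2 (E × E) := fun m => WithLp.toLp 2
    (∑ j : Fin (L + 1), Real.cos (2 * Real.pi * m / (2 * L + 1 : ℕ) * j) • v j,
      ∑ j : Fin (L + 1), Real.sin (2 * Real.pi * m / (2 * L + 1 : ℕ) * j) • v j)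
  have hz := sum_norm_sq_fourier v
  have hz' : ∑ m ∈ Finset.range (2 * L + 1), ‖z m‖ ^ 2 = (2 * L + 1 : ℕ) * ∑ j, ‖v j‖ ^ 2 := by
    rw [← hz]
    exact Finset.sum_congr rfl fun m _ => WithLp.prod_norm_sq_eq_of_L2 _
  have hN : (0 : ℝ) < (2 * L + 1 : ℕ) := by positivity
  have hc : ∀ m : ℕ, phasedPairing w (fun t => 2 * Real.pi * m / (2 * L + 1 : ℕ) * t) (z m)
      = fun s : Fin T => ∑ j : Fin (L + 1),
        Real.cos (2 * Real.pi * m / (2 * L + 1 : ℕ) * (s + j)) * ⟪w s, v j⟫ := by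
    intro m
    ext s
    rw [phasedPairing_apply, rotatedPart_apply]
    simp only [z, WithLp.toLp_fst, WithLp.toLp_snd, inner_sub_right, inner_smul_right, inner_sum,
      Finset.mul_sum]
    rw [← Finset.sum_sub_distrib]
    refine Finset.sum_congr rfl fun j _ => ?_
    rw [mul_add, Real.cos_add]
    ring
  have hs : ∀ m : ℕ, phasedPairing w
      (fun t => 2 * Real.pi * m / (2 * L + 1 : ℕ) * t - Real.pi / 2) (z m)
      = fun s : Fin T => ∑ j : Fin (L + 1),
        Real.sin (2 * Real.pi * m / (2 * L + 1 : ℕ) * (s + j)) * ⟪w s, v j⟫ := by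
    intro m
    ext s
    rw [phasedPairing_apply, rotatedPart_sub_pi_div_two]
    simp only [z, WithLp.toLp_fst, WithLp.toLp_snd, inner_add_right, inner_smul_right, inner_sum,
      Finset.mul_sum]
    rw [← Finset.sum_add_distrib]
    refine Finset.sum_congr rfl fun j _ => ?_
    rw [mul_add, Real.sin_add]
    ring
  -- At `z m`, the Fourier transform of `v`, the angle addition formulas turn the symbol into the
  -- summand of `sum_bandForm_fourier`.
  have key : (2 * L + 1 : ℕ) * (convSq (fun s j => ⟪w s, v j⟫) - T * ∑ j, ‖v j‖ ^ 2)
      = ∑ m ∈ Finset.range (2 * L + 1), symbolForm L w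
        (fun t => 2 * Real.pi * m / (2 * L + 1 : ℕ) * t) (z m) (z m) := by
    simp_rw [symbolForm_self, hc, hs]
    rw [Finset.sum_sub_distrib, sum_bandForm_fourier (fun s j => ⟪w s, v j⟫), ← Finset.mul_sum, hz']
    ring
  have h1 : (2 * L + 1 : ℕ) * |convSq (fun s j => ⟪w s, v j⟫) - T * ∑ j, ‖v j‖ ^ 2|
      ≤ (2 * L + 1 : ℕ) * (ε * ∑ j, ‖v j‖ ^ 2) := by
    calc _ = |(2 * L + 1 : ℕ) * (convSq (fun s j => ⟪w s, v j⟫) - T * ∑ j, ‖v j‖ ^ 2)| := by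
          rw [abs_mul, abs_of_pos hN]
      _ ≤ ∑ m ∈ Finset.range (2 * L + 1), ε * ‖z m‖ ^ 2 := by
          rw [key]
          exact (Finset.abs_sum_le_sum_abs _ _).trans (Finset.sum_le_sum fun m hm => h m hm _)
      _ = _ := by rw [← Finset.mul_sum, hz']; ring
  exact le_of_mul_le_mul_left h1 hN
end

/-! ### Union bound over frequencies and directions. -/

section
variable {Ω : Type*} [MeasurableSpace Ω] {μ : Measure Ω} [IsProbabilityMeasure μ]
  {E : Type*} [NormedAddCommGroup E] [InnerProductSpace ℝ E] [FiniteDimensional ℝ E]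
  [MeasurableSpace E] [BorelSpace E]

/-- The events are `2 * L + 1` frequencies, two phases and at most `2 * 25^(2 dim E)` directions,
each of probability at most `2 exp (-s)`. The constant `768 = 8 * 2 * 48` combines the net factor,
the two phases and the scalar bound. -/
theorem measure_not_convSq_le {T L : ℕ} {u : Fin T → Ω → E} (hind : iIndepFun u μ) {κ : ℝ}
    (hκ : 0 < κ) (hc : ∀ t c, ‖c‖ ≤ 1 → CentredSqExp (fun ω => ⟪u t ω, c⟫) κ μ)
    (hv : ∀ t c, ∫ ω, ⟪u t ω, c⟫ ^ 2 ∂μ = ‖c‖ ^ 2) (hL : 1 ≤ L) (hLT : L ≤ T) {s : ℝ}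
    (hs : 0 ≤ s) :
    μ {ω | ¬ ∀ v : Fin (L + 1) → E,
        |convSq (fun t j => ⟪u t ω, v j⟫) - T * ∑ j, ‖v j‖ ^ 2|
          ≤ 768 * κ * (√(s * L * T) + L * s) * ∑ j, ‖v j‖ ^ 2}
      ≤ ENNReal.ofReal (8 * (2 * L + 1) * 625 ^ Module.finrank ℝ E * Real.exp (-s)) := by
  set τ := 48 * κ * (√(s * L * T) + L * s) with hτ
  obtain ⟨Z, hZcard, hZ1, hZ⟩ := exists_finset_control_quadratic (WithLp 2 (E × E))
  let φ : ℕ → Fin T → ℝ := fun m t => 2 * Real.pi * m / (2 * L + 1 : ℕ) * t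
  let bad : (Fin T → ℝ) → WithLp 2 (E × E) → Set Ω := fun ψ z =>
    {ω | τ ≤ |bandForm L (phasedPairing (u · ω) ψ z) - ∑ t, ‖rotatedPart (ψ t) z‖ ^ 2|}
  have hbad : ∀ ψ, ∀ z ∈ Z, μ (bad ψ z) ≤ 2 * ENNReal.ofReal (Real.exp (-s)) := by
    intro ψ z hz
    have hi := hind.comp (fun t y => ⟪y, rotatedPart (ψ t) z⟫) (fun t => by fun_prop)
    have := measure_abs_bandForm_sub_ge_le hi hκ
      (fun t => hc t _ ((norm_rotatedPart_le _ _).trans (hZ1 z hz))) hL hLT hs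
    simp only [Function.comp_apply, hv] at this
    exact this
  have hsub : {ω | ¬ ∀ v : Fin (L + 1) → E,
        |convSq (fun t j => ⟪u t ω, v j⟫) - T * ∑ j, ‖v j‖ ^ 2|
          ≤ 768 * κ * (√(s * L * T) + L * s) * ∑ j, ‖v j‖ ^ 2}
      ⊆ ⋃ p ∈ Finset.range (2 * L + 1) ×ˢ Z,
        (bad (φ p.1) p.2 ∪ bad (fun t => φ p.1 t - Real.pi / 2) p.2) := by
    intro ω hω
    by_contra hnot
    simp only [Set.mem_iUnion, not_exists, Set.mem_union, not_or] at hnot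
    refine hω fun v => ?_
    have he : 768 * κ * (√(s * L * T) + L * s) = 8 * (2 * τ) := by rw [hτ]; ring
    rw [he]
    refine abs_convSq_sub_le_of_symbolForm (u · ω) (fun m hm => ?_) v
    refine hZ _ (symbolForm_comm L _ _) _ fun z hz => ?_
    obtain ⟨h1, h2⟩ := hnot (m, z) (Finset.mk_mem_product hm hz)
    simp only [bad, Set.mem_ofPred_eq, not_le] at h1 h2
    have h3 : (T : ℝ) * ‖z‖ ^ 2 = ∑ t, ‖rotatedPart (φ m t) z‖ ^ 2
        + ∑ t, ‖rotatedPart (φ m t - Real.pi / 2) z‖ ^ 2 := by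
      rw [← Finset.sum_add_distrib]
      simp [norm_rotatedPart_sq_add]
    rw [symbolForm_self, h3, abs_le]
    rw [abs_lt] at h1 h2
    constructor <;> linarith [h1.1, h1.2, h2.1, h2.2]
  calc _ ≤ _ := measure_mono hsub
    _ ≤ ∑ p ∈ Finset.range (2 * L + 1) ×ˢ Z,
        μ (bad (φ p.1) p.2 ∪ bad (fun t => φ p.1 t - Real.pi / 2) p.2) :=
          measure_biUnion_finset_le _ _
    _ ≤ ∑ p ∈ Finset.range (2 * L + 1) ×ˢ Z, ENNReal.ofReal (4 * Real.exp (-s)) := by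
        refine Finset.sum_le_sum fun p hp => (measure_union_le _ _).trans ?_
        have hz := (Finset.mem_product.1 hp).2
        refine (add_le_add (hbad _ _ hz) (hbad _ _ hz)).trans (le_of_eq ?_)
        rw [← add_mul, ENNReal.ofReal_mul (by norm_num)]
        norm_num
    _ = ENNReal.ofReal (((2 * L + 1) * Z.card : ℕ) * (4 * Real.exp (-s))) := by
        rw [Finset.sum_const, Finset.card_product, Finset.card_range, nsmul_eq_mul,
          ENNReal.ofReal_mul (p := (((2 * L + 1) * Z.card : ℕ) : ℝ)) (by positivity),
          ENNReal.ofReal_natCast]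
    _ ≤ _ := by
        apply ENNReal.ofReal_le_ofReal
        have h1 : (Z.card : ℝ) ≤ 2 * 625 ^ Module.finrank ℝ E := by
          have h2 : Module.finrank ℝ (WithLp 2 (E × E)) = 2 * Module.finrank ℝ E := by
            rw [(WithLp.linearEquiv 2 ℝ (E × E)).finrank_eq, Module.finrank_prod]; ring
          rw [h2, pow_mul] at hZcard
          norm_num at hZcard
          exact_mod_cast hZcard
        push_cast
        calc (2 * L + 1) * (Z.card : ℝ) * (4 * Real.exp (-s))
            ≤ (2 * L + 1) * (2 * 625 ^ Module.finrank ℝ E) * (4 * Real.exp (-s)) := by gcongr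
          _ = _ := by ring
end

/-! ### Truncation to `T` rows and passage to the operator norm. -/

/-- The squared norm of the first `T` entries of the convolution of the array `f`. -/
def truncConvSq {T L : ℕ} (f : Fin T → Fin (L + 1) → ℝ) : ℝ :=
  ∑ i ∈ Finset.range T, (∑ s : Fin T, ∑ j : Fin (L + 1),
    if s.val + j.val = i then f s j else 0) ^ 2

/-- The position in `Fin T` of the `s`-th of the last `L` indices. -/
def lastIndex {T L : ℕ} (hLT : L ≤ T) (s : Fin L) : Fin T := ⟨T - L + s, by omega⟩

theorem lastIndex_injective {T L : ℕ} (hLT : L ≤ T) :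
    Function.Injective (lastIndex hLT) := fun s t h => by
  simp only [lastIndex, Fin.ext_iff] at h ⊢
  omega

theorem truncConvSq_le_convSq {T L : ℕ} (f : Fin T → Fin (L + 1) → ℝ) :
    truncConvSq f ≤ convSq f :=
  Finset.sum_le_sum_of_subset_of_nonneg (Finset.range_subset_range.2 (Nat.le_add_right T L))
    fun _ _ _ => sq_nonneg _

/-- Since `j ≤ L`, rows `T, …, T + L - 1` see only the last `L` inputs. They are the rows `L, …, 2L
- 1` of the convolution of those inputs, whose other rows contribute nonnegatively. -/
theorem convSq_le_truncConvSq_add {T L : ℕ} (hLT : L ≤ T) (f : Fin T → Fin (L + 1) → ℝ) :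
    convSq f ≤ truncConvSq f + convSq fun s => f (lastIndex hLT s) := by
  have h1 : ∀ r : ℕ, (∑ s : Fin T, ∑ j : Fin (L + 1), if s.val + j.val = T + r then f s j else 0)
      = ∑ s : Fin L, ∑ j : Fin (L + 1),
        if s.val + j.val = L + r then f (lastIndex hLT s) j else 0 := by
    intro r
    symm
    refine Fintype.sum_of_injective (lastIndex hLT) (lastIndex_injective hLT) _ _ ?_ ?_
    · intro s hs
      refine Finset.sum_eq_zero fun j _ => if_neg fun h => hs ?_
      refine ⟨⟨s.val - (T - L), by omega⟩, ?_⟩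
      simp only [lastIndex, Fin.ext_iff]
      omega
    · intro s
      refine Finset.sum_congr rfl fun j _ => if_congr ?_ rfl rfl
      simp only [lastIndex]
      omega
  unfold convSq truncConvSq
  rw [Finset.sum_range_add, Finset.sum_range_add _ L L]
  simp_rw [h1]
  have h2 : 0 ≤ ∑ i ∈ Finset.range L, (∑ s : Fin L, ∑ j : Fin (L + 1),
      if s.val + j.val = i then f (lastIndex hLT s) j else 0) ^ 2 :=
    Finset.sum_nonneg fun _ _ => sq_nonneg _
  linarith

theorem inputMatrix_mulVec {d T L : ℕ} (u : Fin T → EuclideanSpace ℝ (Fin d))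
    (x : Fin (L + 1) × Fin d → ℝ) (i : Fin T × Fin 1) :
    (inputMatrix L u *ᵥ x) i = ∑ s : Fin T, ∑ j : Fin (L + 1),
      if s.val + j.val = i.1.val then ⟪u s, WithLp.toLp 2 fun a => x (j, a)⟫ else 0 := by
  rw [Matrix.mulVec, dotProduct, Fintype.sum_prod_type, Finset.sum_comm (γ := Fin T)]
  refine Finset.sum_congr rfl fun j _ => ?_
  by_cases h : j.val ≤ i.1.val
  · rw [Finset.sum_eq_single_of_mem (⟨i.1.val - j.val, by omega⟩ : Fin T) (Finset.mem_univ _)]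
    · rw [if_pos (by simp only; omega), PiLp.inner_apply]
      refine Finset.sum_congr rfl fun a _ => ?_
      simp only [inputMatrix, blockToeplitz, Matrix.of_apply, if_pos h, rowMatrix,
        RCLike.inner_apply, conj_trivial]
      ring
    · intro s _ hs
      refine if_neg fun h' => hs ?_
      rw [Fin.ext_iff]
      simp only
      omega
  · rw [Finset.sum_eq_zero fun s _ => if_neg (by omega)]
    refine Finset.sum_eq_zero fun a _ => ?_
    simp only [inputMatrix, blockToeplitz, Matrix.of_apply, if_neg h, zero_mul]

theorem norm_sq_inputMatrix_mulVec {d T L : ℕ} (u : Fin T → EuclideanSpace ℝ (Fin d))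
    (x : Fin (L + 1) × Fin d → ℝ) :
    (inputMatrix L u *ᵥ x) ⬝ᵥ (inputMatrix L u *ᵥ x)
      = truncConvSq fun s j => ⟪u s, WithLp.toLp 2 fun a => x (j, a)⟫ := by
  rw [dotProduct, Fintype.sum_prod_type, truncConvSq, Finset.sum_range]
  refine Finset.sum_congr rfl fun i _ => ?_
  rw [Fin.sum_univ_one, inputMatrix_mulVec, sq]

/-- The norm of a symmetric operator is the supremum of its absolute Rayleigh quotients, and here
the numerator is the centred truncated form. -/
theorem norm_gram_sub_le {d T L : ℕ} (u : Fin T → EuclideanSpace ℝ (Fin d)) {ε : ℝ} (hε : 0 ≤ ε)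
    (h : ∀ v : Fin (L + 1) → EuclideanSpace ℝ (Fin d),
      |truncConvSq (fun s j => ⟪u s, v j⟫) - T * ∑ j, ‖v j‖ ^ 2| ≤ ε * ∑ j, ‖v j‖ ^ 2) :
    ‖(inputMatrix L u)ᵀ * inputMatrix L u
      - (T : ℝ) • (1 : Matrix (Fin (L + 1) × Fin d) (Fin (L + 1) × Fin d) ℝ)‖ ≤ ε := by
  set U := inputMatrix L u
  set A := Uᵀ * U - (T : ℝ) • (1 : Matrix (Fin (L + 1) × Fin d) (Fin (L + 1) × Fin d) ℝ) with hA
  have hAt : Aᵀ = A := by simp [hA]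
  have hin : ∀ x y, ⟪Matrix.toEuclideanCLM (𝕜 := ℝ) A x, y⟫ = y.ofLp ⬝ᵥ A *ᵥ x.ofLp := by
    intro x y
    rw [real_inner_comm, Matrix.inner_toEuclideanCLM]
  have hsymm : (↑(Matrix.toEuclideanCLM (𝕜 := ℝ) A) :
      EuclideanSpace ℝ (Fin (L + 1) × Fin d) →ₗ[ℝ] _).IsSymmetric := by
    intro x y
    change ⟪Matrix.toEuclideanCLM (𝕜 := ℝ) A x, y⟫ = ⟪x, Matrix.toEuclideanCLM (𝕜 := ℝ) A y⟫
    rw [real_inner_comm _ x, hin, hin, Matrix.dotProduct_mulVec, ← Matrix.mulVec_transpose, hAt,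
      dotProduct_comm]
  rw [← Matrix.l2_opNorm_toEuclideanCLM, ContinuousLinearMap.norm_eq_iSup_rayleighQuotient _ hsymm]
  refine ciSup_le fun x => ?_
  let v : Fin (L + 1) → EuclideanSpace ℝ (Fin d) := fun j => WithLp.toLp 2 fun a => x (j, a)
  have hv : ∑ j, ‖v j‖ ^ 2 = ‖x‖ ^ 2 := by
    rw [EuclideanSpace.norm_sq_eq, Fintype.sum_prod_type]
    exact Finset.sum_congr rfl fun j _ => EuclideanSpace.norm_sq_eq _
  have hq : ⟪Matrix.toEuclideanCLM (𝕜 := ℝ) A x, x⟫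
      = truncConvSq (fun s j => ⟪u s, v j⟫) - T * ∑ j, ‖v j‖ ^ 2 := by
    rw [hin, hv, hA, Matrix.sub_mulVec, dotProduct_sub, Matrix.smul_mulVec, Matrix.one_mulVec,
      dotProduct_smul, ← Matrix.mulVec_mulVec, Matrix.dotProduct_mulVec, Matrix.vecMul_transpose,
      norm_sq_inputMatrix_mulVec, smul_eq_mul, EuclideanSpace.norm_sq_eq]
    simp [dotProduct, sq, v]
  have hr : (Matrix.toEuclideanCLM (𝕜 := ℝ) A).rayleighQuotient x
      = ⟪Matrix.toEuclideanCLM (𝕜 := ℝ) A x, x⟫ / ‖x‖ ^ 2 := rfl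
  rw [hr, hq, abs_div, abs_of_nonneg (sq_nonneg ‖x‖)]
  refine div_le_of_le_mul₀ (sq_nonneg _) hε ?_
  rw [← hv]
  exact h v

/-! ### Constants and conclusion. -/

theorem union_bound_numeric {d L T : ℕ} {δ : ℝ} (hd : 1 ≤ d) (hL : 1 ≤ L) (hLT : L ≤ T)
    (hδ : 0 < δ) (hδ2 : δ ≤ 1 / 2) :
    8 * (2 * L + 1) * 625 ^ d * Real.exp (-(20 * d * Real.log (T / δ))) ≤ δ / 2 := by
  have hT1 : (1 : ℝ) ≤ T := by exact_mod_cast hL.trans hLT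
  have hL1 : (1 : ℝ) ≤ L := by exact_mod_cast hL
  have hLT' : (L : ℝ) ≤ T := by exact_mod_cast hLT
  have hT0 : (0 : ℝ) < T := by linarith
  set q := δ / T with hq
  have hq0 : 0 < q := by positivity
  have hq2 : q ≤ 1 / 2 := (div_le_self hδ.le hT1).trans hδ2
  -- One power `q ^ d ≤ δ / T` pays for the frequencies and for `δ`; the other nineteen, with `q ≤ 1
  -- / 2`, beat the net factor `625 ^ d`.
  have he : Real.exp (-(20 * d * Real.log (T / δ))) = q ^ d * (q ^ 19) ^ d := by
    have h1 : -(20 * d * Real.log (T / δ)) = ((20 * d : ℕ) : ℝ) * Real.log q := by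
      rw [hq, ← inv_div, Real.log_inv]; push_cast; ring
    rw [h1, Real.exp_nat_mul, Real.exp_log hq0, pow_mul, ← mul_pow, ← pow_succ']
  have h19 : q ^ 19 * 625 ≤ 1 / 800 := by
    have : q ^ 19 ≤ (1 / 2) ^ 19 := pow_le_pow_left₀ hq0.le hq2 19
    norm_num at this ⊢
    linarith
  have hd1 : (q ^ 19 * 625) ^ d ≤ 1 / 800 :=
    (pow_le_of_le_one (by positivity) (by linarith) (by omega)).trans h19
  have hd2 : q ^ d ≤ q := pow_le_of_le_one hq0.le (by linarith) (by omega)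
  calc _ = 8 * (2 * L + 1) * q ^ d * (q ^ 19 * 625) ^ d := by rw [he, mul_pow]; ring
    _ ≤ 8 * (2 * T + T) * q * (1 / 800) := by gcongr
    _ = 24 / 800 * δ := by rw [hq]; field_simp; norm_num
    _ ≤ δ / 2 := by linarith

theorem deviation_bound_numeric {d L T : ℕ} {K l : ℝ} (hd : 1 ≤ d) (hLT : L ≤ T) (hK : 1 ≤ K)
    (hl : 1 / 2 ≤ l) :
    768 * (4 * K ^ 2) * (√(20 * d * l * L * T) + L * (20 * d * l))
      + 768 * (4 * K ^ 2) * (√(20 * d * l * L * L) + L * (20 * d * l)) + L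
      ≤ 130000 * K ^ 2 * (L * d * l + √(T * L * d * l)) := by
  have hd1 : (1 : ℝ) ≤ d := by exact_mod_cast hd
  have hLT' : (L : ℝ) ≤ T := by exact_mod_cast hLT
  have hl0 : 0 ≤ l := by linarith
  set q := √(T * L * d * l) with hq
  have hq0 : 0 ≤ q := Real.sqrt_nonneg _
  have h1 : √(20 * d * l * L * T) ≤ 20 * q := by
    rw [hq, show (20 : ℝ) = √(20 ^ 2) by rw [Real.sqrt_sq (by norm_num)],
      ← Real.sqrt_mul (by positivity), Real.sqrt_sq (by norm_num)]
    apply Real.sqrt_le_sqrt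
    have : 0 ≤ T * L * d * l := by positivity
    nlinarith
  have h2 : √(20 * d * l * L * L) ≤ 20 * q := by
    refine (Real.sqrt_le_sqrt ?_).trans h1
    gcongr
  -- Here `K ≥ 1`, `d ≥ 1` and `l ≥ 1 / 2` absorb the mean of the truncated rows.
  have h3 : (L : ℝ) ≤ 2 * K ^ 2 * (L * d * l) := by
    have hK2 : 1 ≤ K ^ 2 := one_le_pow₀ hK
    have h5 : 1 ≤ 2 * (K ^ 2 * (d * l)) := by
      have : 1 / 2 ≤ d * l := by nlinarith
      nlinarith
    calc (L : ℝ) = L * 1 := (mul_one _).symm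
      _ ≤ L * (2 * (K ^ 2 * (d * l))) := by gcongr
      _ = _ := by ring
  have hw : 0 ≤ K ^ 2 * (L * d * l) := by positivity
  have hw' : 0 ≤ K ^ 2 * q := by positivity
  calc _ ≤ 768 * (4 * K ^ 2) * (20 * q + L * (20 * d * l))
      + 768 * (4 * K ^ 2) * (20 * q + L * (20 * d * l)) + 2 * K ^ 2 * (L * d * l) := by gcongr
    _ = 122882 * (K ^ 2 * (L * d * l)) + 122880 * (K ^ 2 * q) := by ring
    _ ≤ 130000 * (K ^ 2 * (L * d * l)) + 130000 * (K ^ 2 * q) := by linarith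
    _ = _ := by ring

theorem ofReal_one_sub_le_measure {Ω : Type*} [MeasurableSpace Ω] {μ : Measure Ω}
    [IsProbabilityMeasure μ] {S A B : Set Ω} {δ : ℝ} (hδ : 0 < δ) (hS : Sᶜ ⊆ A ∪ B)
    (hA : μ A ≤ ENNReal.ofReal (δ / 2)) (hB : μ B ≤ ENNReal.ofReal (δ / 2)) :
    ENNReal.ofReal (1 - δ) ≤ μ S := by
  have h1 : μ Sᶜ ≤ ENNReal.ofReal δ := by
    refine (measure_mono hS).trans ((measure_union_le _ _).trans ((add_le_add hA hB).trans ?_))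
    rw [← ENNReal.ofReal_add (by positivity) (by positivity), add_halves]
  have h2 : 1 ≤ μ S + ENNReal.ofReal δ := by
    calc 1 = μ (S ∪ Sᶜ) := by rw [Set.union_compl_self, measure_univ]
      _ ≤ μ S + μ Sᶜ := measure_union_le _ _
      _ ≤ _ := by gcongr
  rw [ENNReal.ofReal_sub _ hδ.le, ENNReal.ofReal_one]
  exact tsub_le_iff_right.2 h2

theorem mainTheorem4 :
    ∃ C : ℝ, 0 < C ∧
      ∀ (Ω : Type*) [MeasurableSpace Ω] (μ : Measure Ω) [IsProbabilityMeasure μ]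
        (d L T : ℕ) (K : ℝ≥0) (δ : ℝ) (u : Fin T → Ω → EuclideanSpace ℝ (Fin d)),
        1 ≤ L → L ≤ T → 0 < δ → δ ≤ 1 / 2 →
        (∀ t, Measurable (u t)) →
        iIndepFun u μ →
        (∀ t, ∫ ω, u t ω ∂μ = 0) →
        (∀ t, IsIsotropic μ (u t)) →
        (∀ t, IsSubGaussianVec μ (u t) K) →
        ENNReal.ofReal (1 - δ) ≤
          μ {ω | ‖(inputMatrix L fun t => u t ω)ᵀ * (inputMatrix L fun t => u t ω)
                - (T : ℝ) • (1 : Matrix (Fin (L + 1) × Fin d) (Fin (L + 1) × Fin d) ℝ)‖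
              ≤ C * (K : ℝ) ^ 2 *
                ((L : ℝ) * (d : ℝ) * Real.log ((T : ℝ) / δ)
                  + Real.sqrt ((T : ℝ) * (L : ℝ) * (d : ℝ) * Real.log ((T : ℝ) / δ)))} := by
  refine ⟨130000, by norm_num, ?_⟩
  intro Ω _ μ _ d L T K δ u hL hLT hδ hδ2 hm hind h0 hI hsub
  -- For `d = 0` the matrix is empty; this case is separate because `K ≥ 1` needs a unit vector.
  rcases Nat.eq_zero_or_pos d with rfl | hd
  · have hnorm : ∀ A : Matrix (Fin (L + 1) × Fin 0) (Fin (L + 1) × Fin 0) ℝ, ‖A‖ = 0 := fun A => by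
      rw [Subsingleton.elim A 0, norm_zero]
    simp [hnorm, hδ.le]
  have hK := (hsub ⟨0, by omega⟩).one_le hd (hm _) (hI _)
  have hκ : (0 : ℝ) < 4 * K ^ 2 := by positivity
  have hc : ∀ t c, ‖c‖ ≤ 1 → CentredSqExp (fun ω => ⟪u t ω, c⟫) (4 * K ^ 2) μ := fun t c h =>
    (hsub t).centredSqExp_inner hK (hm t) (h0 t) (hI t) h
  have hv : ∀ t c, ∫ ω, ⟪u t ω, c⟫ ^ 2 ∂μ = ‖c‖ ^ 2 := fun t c => (hI t).integral_inner_sq (hm t) c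
  have hT1 : (1 : ℝ) ≤ T := by exact_mod_cast hL.trans hLT
  have hl : 1 / 2 ≤ Real.log (T / δ) := by
    have h2 : (2 : ℝ) ≤ T / δ := by
      rw [le_div_iff₀ hδ]; linarith
    have := Real.log_le_log (by norm_num) h2
    linarith [Real.log_two_gt_d9]
  have hs : 0 ≤ 20 * d * Real.log (T / δ) := by
    have : 0 ≤ Real.log (T / δ) := by linarith
    positivity
  have hnum := ENNReal.ofReal_le_ofReal (union_bound_numeric hd hL hLT hδ hδ2)
  have hbad1 := measure_not_convSq_le hind hκ hc hv hL hLT hs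
  have hind' : iIndepFun (fun t => u (lastIndex hLT t)) μ :=
    hind.precomp (lastIndex_injective hLT)
  have hbad2 := measure_not_convSq_le hind' hκ
    (fun t => hc (lastIndex hLT t)) (fun t => hv (lastIndex hLT t)) hL le_rfl hs
  rw [finrank_euclideanSpace_fin] at hbad1 hbad2
  refine ofReal_one_sub_le_measure hδ ?_ (hbad1.trans hnum) (hbad2.trans hnum)
  intro ω hω
  by_contra hgood
  simp only [Set.mem_union, Set.mem_ofPred_eq, not_or, not_not] at hgood
  obtain ⟨hg1, hg2⟩ := hgood
  refine hω ?_
  refine (norm_gram_sub_le (fun t => u t ω) ?_ fun v => ?_).trans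
    (deviation_bound_numeric (l := Real.log (T / δ)) hd hLT hK hl)
  · positivity
  · have e1 := abs_le.1 (hg1 v)
    have e2 := abs_le.1 (hg2 v)
    -- The truncated form lies between the full form minus that of the last `L` inputs, which is at
    -- most `L` plus its deviation times `∑ j, ‖v j‖ ^ 2`, and the full form itself.
    have e3 := truncConvSq_le_convSq fun t j => ⟪u t ω, v j⟫
    have e4 := convSq_le_truncConvSq_add hLT fun t j => ⟪u t ω, v j⟫
    have hV : 0 ≤ ∑ j, ‖v j‖ ^ 2 := Finset.sum_nonneg fun _ _ => sq_nonneg _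
    have hLV : 0 ≤ (L : ℝ) * ∑ j, ‖v j‖ ^ 2 := by positivity
    have p2 : 0 ≤ 768 * (4 * (K : ℝ) ^ 2) * (√(20 * d * Real.log (T / δ) * L * L)
        + L * (20 * d * Real.log (T / δ))) * ∑ j, ‖v j‖ ^ 2 := by positivity
    rw [abs_le, add_mul, add_mul]
    constructor <;> linarith [e1.1, e1.2, e2.1, e2.2]
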